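/- \textbf{Lemma (uniform gradient estimate).} Let $m\ge 2$, and let $\langle p,q\rangle=-p^0q^0+\sum_{i=1}^m p^iq^i$ be the Minkowski product on $\mathbb{L}^{m+1}=\mathbb{R}^{m+1}$. Let $\mathbb{H}^m=\{q:\langle q,q\rangle=-1,\ q^0>0\}$, with induced metric $h$ and geodesic distance $d(p,q)=\operatorname{arcosh}(-\langle p,q\rangle)$, and let $B_r\subset\mathbb{H}^m$ denote a geodesic ball of radius $r$ with arbitrary centre. Fix an origin $o\in\mathbb{L}^{m+1}$. For a function $u$ on $\overline{B_r}$ let $\Sigma_u$ be its radial graph, parametrized by $F_u(q)=o+e^{u(q)}q$. Let $g=F_u^*\langle\cdot,\cdot\rangle$ be the induced metric; $\Sigma_u$ is spacelike if $g$ is positive definite. In that case let $N$ be the future-pointing unit normal, $H=\frac1m\operatorname{tr}_g \mathrm{II}$ the mean curvature, where $\mathrm{II}(X,Y)=-\langle\overline\nabla_{F_*X}F_*Y,N\rangle$, and $w=-\langle T,N\rangle$ the tilt function, where $T(p)=(p-o)/\sqrt{|\langle p-o,p-o\rangle|}$. Let $|\nabla H|$ be the $g$-norm of the gradient of $H$,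 and $|Du|$ the $h$-norm of the gradient of $u$. Let $0<l\le 1\le L<\infty$ and $\Lambda,R>0$. There exists a constant $C=C(l,L,\Lambda,R,m)$ such that, for every origin $o$, every $r>R$, every geodesic ball $B_r\subset\mathbb{H}^m$ of radius $r$ and every $u\in C^3(\overline{B_r})$ whose radial graph $\Sigma_u$ over $\overline{B_r}$ is spacelike and which satisfies \begin{enumerate} \item[(h1)] $\ln l\le u\le \ln L$ in $\overline{B_r}$, \item[(h2)] $|H|\le\Lambda$ and $|\nabla H|\le\Lambda w$ in $B_r$, \item[(h3)] $u$ is constant on $\partial B_r$, \end{enumerate} one has $$|Du|<1\quad\text{and}\quad w=\frac{1}{\sqrt{1-|Du|^2}}\le C\qquad\text{in }\overline{B_r}.$$ In particular, $C$ does not depend on $r$, on the centre of the ball, or on $u$. -/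

import Mathlib

noncomputable section

namespace RadialGraph

/-- The coordinate space `ℝᵐ` with its Euclidean structure. -/
abbrev Coord (m : ℕ) : Type := EuclideanSpace ℝ (Fin m)

/-- The underlying vector space `ℝ × ℝᵐ` of the Lorentz--Minkowski space; the first component is the
time component `x⁰`. -/
abbrev Mink (m : ℕ) : Type := ℝ × Coord m

/-- The Minkowski scalar product `-(dx⁰)² + (dx¹)² + ⋯ + (dxᵐ)²`. -/
def mink {m : ℕ} (p q : Mink m) : ℝ := -(p.1 * q.1) + ∑ i, p.2 i * q.2 i

/-- The future unit hyperboloid, i.e. the hyperboloid model of the hyperbolic space `ℍᵐ`. -/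
def hyperboloid (m : ℕ) : Set (Mink m) :=
  {q | mink q q = -1 ∧ mink q (1, 0) < 0}

/-- The hyperbolic (geodesic) distance in the hyperboloid model: `cosh d(p, q) = -⟨p, q⟩`. -/
def hypDist {m : ℕ} (p q : hyperboloid m) : ℝ := Real.arcosh (-mink p.1 q.1)

theorem graph_mem_hyperboloid {m : ℕ} (x : Coord m) :
    ((Real.sqrt (1 + ‖x‖ ^ 2), x) : Mink m) ∈ hyperboloid m := by
  have h1 : (0 : ℝ) < 1 + ‖x‖ ^ 2 := by positivity
  have h2 : ∑ i, x i * x i = ‖x‖ ^ 2 := by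
    rw [EuclideanSpace.real_norm_sq_eq]
    exact Finset.sum_congr rfl fun i _ => (pow_two (x i)).symm
  refine ⟨?_, ?_⟩
  · simp only [mink, h2, Real.mul_self_sqrt h1.le]
    ring
  · simp [mink, Real.sqrt_pos.2 h1]

/-- The global coordinates on `ℍᵐ` given by the spatial components: the parametrization
`x ↦ (√(1 + |x|²), x)`, a smooth diffeomorphism from `ℝᵐ` onto the hyperboloid. -/
def hypPoint {m : ℕ} (x : Coord m) : hyperboloid m :=
  ⟨(Real.sqrt (1 + ‖x‖ ^ 2), x), graph_mem_hyperboloid x⟩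

/-- The closed geodesic ball of centre `p` and radius `r`, in these coordinates. -/
def closedBallCoord {m : ℕ} (p : hyperboloid m) (r : ℝ) : Set (Coord m) :=
  {x | hypDist p (hypPoint x) ≤ r}

/-! ### Parametrized hypersurfaces

`X : ℝᵐ → ℝ × ℝᵐ` is a parametrized hypersurface over a set `D`; all derivatives are taken within
`D`, so that they also make sense (as one-sided derivatives) at the boundary of `D`. -/

/-- The partial derivative `∂ᵢ f` within `D`. -/
def partialWithin {m : ℕ} {V : Type} [NormedAddCommGroup V] [NormedSpace ℝ V]
    (D : Set (Coord m)) (f : Coord m → V) (i : Fin m) (x : Coord m) : V :=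
  fderivWithin ℝ f D x (EuclideanSpace.single i 1)

/-- The induced metric `gᵢⱼ = ⟨∂ᵢX, ∂ⱼX⟩`. -/
def inducedMetric {m : ℕ} (D : Set (Coord m)) (X : Coord m → Mink m) (x : Coord m) :
    Matrix (Fin m) (Fin m) ℝ :=
  Matrix.of fun i j => mink (partialWithin D X i x) (partialWithin D X j x)

/-- `X` is spacelike over `D`: the induced metric is Riemannian, i.e. positive definite. -/
def IsSpacelike {m : ℕ} (D : Set (Coord m)) (X : Coord m → Mink m) : Prop :=
  ∀ x ∈ D, (inducedMetric D X x).PosDef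

/-- The norm `√(gⁱʲ ∂ᵢf ∂ⱼf)` of the gradient of `f` with respect to the induced metric of `X`. -/
def gradNorm {m : ℕ} (D : Set (Coord m)) (X : Coord m → Mink m) (f : Coord m → ℝ)
    (x : Coord m) : ℝ :=
  Real.sqrt (∑ i, ∑ j,
    (inducedMetric D X x)⁻¹ i j * partialWithin D f i x * partialWithin D f j x)

/-- `n` is a future-pointing timelike unit normal of `X` at `x`. -/
def IsFutureUnitNormal {m : ℕ} (D : Set (Coord m)) (X : Coord m → Mink m) (x : Coord m)
    (n : Mink m) : Prop :=
  mink n n = -1 ∧ mink n (1, 0) < 0 ∧ ∀ i, mink n (partialWithin D X i x) = 0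

/-- The future-pointing unit normal `N` of `X` (it exists and is unique where `X` is spacelike). -/
def unitNormal {m : ℕ} (D : Set (Coord m)) (X : Coord m → Mink m) (x : Coord m) : Mink m :=
  Classical.epsilon (IsFutureUnitNormal D X x)

/-- The second fundamental form `IIᵢⱼ = -⟨∂ᵢ∂ⱼX, N⟩`. -/
def secondFundForm {m : ℕ} (D : Set (Coord m)) (X : Coord m → Mink m) (x : Coord m) :
    Matrix (Fin m) (Fin m) ℝ :=
  Matrix.of fun i j =>
    -mink (partialWithin D (fun y => partialWithin D X j y) i x) (unitNormal D X x)

/-- The mean curvature `H = (1/m) gⁱʲ IIᵢⱼ`, the mean of the principal curvatures. -/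
def meanCurvature {m : ℕ} (D : Set (Coord m)) (X : Coord m → Mink m) (x : Coord m) : ℝ :=
  (1 / (m : ℝ)) * ((inducedMetric D X x)⁻¹ * secondFundForm D X x).trace

/-! ### Radial graphs -/

/-- The radial graph map `F_u(q) = o + e^{u(q)} q`, in the coordinates of `ℍᵐ`. -/
def radialGraph {m : ℕ} (o : Mink m) (u : hyperboloid m → ℝ) (x : Coord m) : Mink m :=
  o + Real.exp (u (hypPoint x)) • (hypPoint x : Mink m)

/-- The Lorentzian distance (time separation) `ℓ_o(p) = √|⟨p - o, p - o⟩|`. -/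
def timeSep {m : ℕ} (o p : Mink m) : ℝ := Real.sqrt |mink (p - o) (p - o)|

/-- The future-pointing normalized position vector field `T` with respect to `o`. -/
def positionField {m : ℕ} (o p : Mink m) : Mink m := (timeSep o p)⁻¹ • (p - o)

/-- The tilt function `w = -⟨T, N⟩` of the radial graph of `u`. -/
def tilt {m : ℕ} (D : Set (Coord m)) (o : Mink m) (u : hyperboloid m → ℝ) (x : Coord m) : ℝ :=
  -mink (positionField o (radialGraph o u x)) (unitNormal D (radialGraph o u) x)

/-- The norm `|Du|` of the gradient of `u` in the hyperbolic metric `h`. -/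
def hypGradNorm {m : ℕ} (D : Set (Coord m)) (u : hyperboloid m → ℝ) (x : Coord m) : ℝ :=
  gradNorm D (fun y => (hypPoint y : Mink m)) (fun y => u (hypPoint y)) x

end RadialGraph

end

open RadialGraph

/-! Write `Y = X - o`, `ℓ² = -⟨Y, Y⟩ = e^{2u}` and `ρ = -⟨Y, n⟩ = e^u w`. As `u` is bounded, a bound
for `w` is a bound for the support function `ρ`. The maximum principle is applied to `G = log ρ + k
ℓ² / 2` (`testFn`) with `k = (m - 1) e^{-2c}`, where `c` is the boundary value of `u`. The bounds on
`u` keep `k` between positive constants and carry a bound for `ρ` at a maximum of `G` over to the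
whole ball.

At an interior maximum the critical equation makes the tangential part `Yᵀ` an eigenvector of the
shape operator `A`, with eigenvalue `-kρ` (`deriv_normal_eq_of_critical`). The trace of the Hessian,
rewritten with the Codazzi equation, contains `ρ|A|² - k²ρ|Yᵀ|²` with `|Yᵀ|² = ρ² - ℓ²`
(`trace_inequality`). Knowing one eigenvalue sharpens Cauchy–Schwarz to `|A|² ≥ k²ρ² + (mH + kρ)² /
(m - 1)` (`sum_sq_ge_of_eigenvector`). The first summand absorbs the negative cubic term; the second
leaves `k²ρ³ / (m - 1)`, while all other terms are `O(ρ²)`, since `|∇H| ≤ Λw` and `|Yᵀ| ≤ ρ`. Hence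
`ρ` is bounded (`supportFn_le_of_isLocalMax`).

At a boundary maximum, the boundary of the graph is a geodesic sphere of a scaled hyperboloid, so
`II = β g` on its tangent directions (`boundary_derivatives`), and the mean curvature determines
`II` in the orthogonal direction (`trace_eq_of_umbilic`). The choice of `k` cancels the part of `β`
that does not involve the slope of `u`. The sign of the normal derivative of `G` then bounds `w |Du|
coth r`; as `coth r > 1` and `w² = 1 + w²|Du|²`, the bound on `w` is independent of `r`
(`tilt_sq_le_of_boundary_max`).

In the coordinates `hypPoint` geodesic balls are convex and compact, which makes derivatives within
the closed ball well behaved up to the boundary. -/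

namespace RadialGraph

open Set Filter Topology

section Within

variable {m : ℕ}

/-! ### The Minkowski product as a continuous bilinear map -/

theorem mink_eq_inner (p q : Mink m) : mink p q = -(p.1 * q.1) + inner ℝ p.2 q.2 := by
  simp [mink, PiLp.inner_apply, mul_comm]

/-- The Minkowski product as a continuous bilinear map. -/
noncomputable def minkL (m : ℕ) : Mink m →L[ℝ] Mink m →L[ℝ] ℝ :=
  -((ContinuousLinearMap.mul ℝ ℝ).bilinearComp (ContinuousLinearMap.fst ℝ ℝ (Coord m))
      (ContinuousLinearMap.fst ℝ ℝ (Coord m))) +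
    (isBoundedBilinearMap_inner (𝕜 := ℝ) (E := Coord m)).toContinuousLinearMap.bilinearComp
      (ContinuousLinearMap.snd ℝ ℝ (Coord m))
      (ContinuousLinearMap.snd ℝ ℝ (Coord m))

theorem minkL_apply (p q : Mink m) : minkL m p q = mink p q := by
  simp [minkL, mink_eq_inner]

theorem mink_comm (p q : Mink m) : mink p q = mink q p := by
  simp [mink, mul_comm]

theorem mink_add_left (p q s : Mink m) : mink (p + q) s = mink p s + mink q s := by
  simp [← minkL_apply]

theorem mink_add_right (p q s : Mink m) : mink p (q + s) = mink p q + mink p s := by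
  simp [← minkL_apply]

theorem mink_sub_left (p q s : Mink m) : mink (p - q) s = mink p s - mink q s := by
  simp [← minkL_apply]

theorem mink_sub_right (p q s : Mink m) : mink p (q - s) = mink p q - mink p s := by
  simp [← minkL_apply]

theorem mink_smul_left (a : ℝ) (p q : Mink m) : mink (a • p) q = a * mink p q := by
  simp [← minkL_apply]

theorem mink_smul_right (a : ℝ) (p q : Mink m) : mink p (a • q) = a * mink p q := by
  simp [← minkL_apply]

theorem mink_zero_left (p : Mink m) : mink 0 p = 0 := by
  simp [← minkL_apply]

theorem mink_sum_left {ι : Type*} (s : Finset ι) (f : ι → Mink m) (p : Mink m) :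
    mink (∑ i ∈ s, f i) p = ∑ i ∈ s, mink (f i) p := by
  simp [← minkL_apply, map_sum]

theorem mink_sum_right {ι : Type*} (s : Finset ι) (f : ι → Mink m) (p : Mink m) :
    mink p (∑ i ∈ s, f i) = ∑ i ∈ s, mink p (f i) := by
  simp [← minkL_apply, map_sum]

/-! ### Calculus within a set -/

variable {D : Set (Coord m)} {V : Type} [NormedAddCommGroup V] [NormedSpace ℝ V]

theorem differentiableWithinAt_mink {f g : Coord m → Mink m} {x : Coord m}
    (hf : DifferentiableWithinAt ℝ f D x) (hg : DifferentiableWithinAt ℝ g D x) :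
    DifferentiableWithinAt ℝ (fun y => mink (f y) (g y)) D x := by
  simp only [← minkL_apply]
  exact ((minkL m).hasFDerivWithinAt_of_bilinear hf.hasFDerivWithinAt
    hg.hasFDerivWithinAt).differentiableWithinAt

theorem fderivWithin_mink {f g : Coord m → Mink m} {x : Coord m} (hD : UniqueDiffWithinAt ℝ D x)
    (hf : DifferentiableWithinAt ℝ f D x) (hg : DifferentiableWithinAt ℝ g D x) (ζ : Coord m) :
    fderivWithin ℝ (fun y => mink (f y) (g y)) D x ζ =
      mink (fderivWithin ℝ f D x ζ) (g x) + mink (f x) (fderivWithin ℝ g D x ζ) := by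
  simp only [← minkL_apply]
  rw [((minkL m).hasFDerivWithinAt_of_bilinear hf.hasFDerivWithinAt
    hg.hasFDerivWithinAt).fderivWithin hD]
  simp [add_comm]

theorem fderivWithin_eq_zero_of_const {f : Coord m → ℝ} {c : ℝ} (hf : ∀ y ∈ D, f y = c)
    {x : Coord m} (hx : x ∈ D) : fderivWithin ℝ f D x = 0 := by
  rw [fderivWithin_congr hf (hf x hx), fderivWithin_const_apply]

/-- The second derivative of `f` within `D`. -/
noncomputable def hessWithin (D : Set (Coord m)) (f : Coord m → V) (x ζ η : Coord m) : V :=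
  fderivWithin ℝ (fderivWithin ℝ f D) D x ζ η

theorem differentiableWithinAt_fderivWithin (hD : UniqueDiffOn ℝ D) {f : Coord m → V}
    (hf : ContDiffOn ℝ 2 f D) {x : Coord m} (hx : x ∈ D) :
    DifferentiableWithinAt ℝ (fderivWithin ℝ f D) D x :=
  (hf.fderivWithin (m := 1) hD (by norm_num)).differentiableOn (by norm_num) x hx

theorem differentiableWithinAt_fderivWithin_apply (hD : UniqueDiffOn ℝ D) {f : Coord m → V}
    (hf : ContDiffOn ℝ 2 f D) {x : Coord m} (hx : x ∈ D) (ζ : Coord m) :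
    DifferentiableWithinAt ℝ (fun y => fderivWithin ℝ f D y ζ) D x :=
  (differentiableWithinAt_fderivWithin hD hf hx).clm_apply (differentiableWithinAt_const ζ)

theorem fderivWithin_fderivWithin_apply (hD : UniqueDiffOn ℝ D) {f : Coord m → V}
    (hf : ContDiffOn ℝ 2 f D) {x : Coord m} (hx : x ∈ D) (ζ η : Coord m) :
    fderivWithin ℝ (fun y => fderivWithin ℝ f D y η) D x ζ = hessWithin D f x ζ η := by
  rw [fderivWithin_clm_apply (hD x hx) (differentiableWithinAt_fderivWithin hD hf hx)
    (differentiableWithinAt_const η)]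
  simp [hessWithin]

/-- Symmetry persists at boundary points because a convex set with nonempty interior lies in the
closure of its interior. -/
theorem hessWithin_comm (hD : Convex ℝ D) (hD' : (interior D).Nonempty) {f : Coord m → V}
    (hf : ContDiffOn ℝ 2 f D) {x : Coord m} (hx : x ∈ D) (ζ η : Coord m) :
    hessWithin D f x ζ η = hessWithin D f x η ζ := by
  have h := (hf x hx).isSymmSndFDerivWithinAt (by simp) (uniqueDiffOn_convex hD hD')
    (hD.closure_interior_eq_closure_of_nonempty_interior hD' ▸ subset_closure hx) hx
  exact h ζ η

/-! ### Matrix-valued functions -/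

theorem differentiableWithinAt_matrix_mul {ι : Type*} [Fintype ι] {A B : Coord m → Matrix ι ι ℝ}
    {x : Coord m}
    (hA : ∀ i j, DifferentiableWithinAt ℝ (fun y => A y i j) D x)
    (hB : ∀ i j, DifferentiableWithinAt ℝ (fun y => B y i j) D x) (i j : ι) :
    DifferentiableWithinAt ℝ (fun y => (A y * B y) i j) D x := by
  simp only [Matrix.mul_apply]
  exact DifferentiableWithinAt.fun_sum fun k _ => (hA i k).mul (hB k j)

theorem differentiableWithinAt_matrix_det {ι : Type*} [Fintype ι] [DecidableEq ι]
    {A : Coord m → Matrix ι ι ℝ} {x : Coord m}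
    (hA : ∀ i j, DifferentiableWithinAt ℝ (fun y => A y i j) D x) :
    DifferentiableWithinAt ℝ (fun y => (A y).det) D x := by
  simp only [Matrix.det_apply']
  refine DifferentiableWithinAt.fun_sum fun σ _ => DifferentiableWithinAt.const_mul ?_ _
  have h := (HasFDerivWithinAt.finsetProd (u := Finset.univ) (g := fun i y => A y (σ i) i)
    fun i _ => (hA (σ i) i).hasFDerivWithinAt).differentiableWithinAt
  exact h

theorem differentiableWithinAt_matrix_inv {ι : Type*} [Fintype ι] [DecidableEq ι]
    {A : Coord m → Matrix ι ι ℝ} {x : Coord m}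
    (hA : ∀ i j, DifferentiableWithinAt ℝ (fun y => A y i j) D x) (h0 : (A x).det ≠ 0) (i j : ι) :
    DifferentiableWithinAt ℝ (fun y => (A y)⁻¹ i j) D x := by
  simp only [Matrix.inv_def, Ring.inverse_eq_inv', Matrix.smul_apply, smul_eq_mul]
  refine ((differentiableWithinAt_matrix_det hA).inv h0).mul ?_
  simp only [Matrix.adjugate_apply]
  refine differentiableWithinAt_matrix_det fun a b => ?_
  by_cases h : a = j
  · subst h
    simp only [Matrix.updateRow_self]
    exact differentiableWithinAt_const _
  · simp only [Matrix.updateRow_ne h]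
    exact hA a b

theorem differentiableWithinAt_trace_inv_mul {ι : Type*} [Fintype ι] [DecidableEq ι]
    {A B : Coord m → Matrix ι ι ℝ} {x : Coord m}
    (hA : ∀ i j, DifferentiableWithinAt ℝ (fun y => A y i j) D x)
    (hB : ∀ i j, DifferentiableWithinAt ℝ (fun y => B y i j) D x) (h0 : (A x).det ≠ 0) :
    DifferentiableWithinAt ℝ (fun y => ((A y)⁻¹ * B y).trace) D x := by
  simp only [Matrix.trace, Matrix.diag_apply]
  exact DifferentiableWithinAt.fun_sum fun i _ =>
    differentiableWithinAt_matrix_mul (differentiableWithinAt_matrix_inv hA h0) hB i i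

/-- The derivative of `tr (A⁻¹ B)` is `tr (A⁻¹ B') - tr (A⁻¹ A' A⁻¹ B)`. -/
theorem fderivWithin_trace_inv_mul {ι : Type*} [Fintype ι] [DecidableEq ι]
    {A B : Coord m → Matrix ι ι ℝ} {x : Coord m} (hD : UniqueDiffWithinAt ℝ D x) (hx : x ∈ D)
    (hA : ∀ i j, DifferentiableWithinAt ℝ (fun y => A y i j) D x)
    (hB : ∀ i j, DifferentiableWithinAt ℝ (fun y => B y i j) D x)
    (h0 : ∀ y ∈ D, (A y).det ≠ 0) (η : Coord m) :
    fderivWithin ℝ (fun y => ((A y)⁻¹ * B y).trace) D x η =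
      ((A x)⁻¹ * Matrix.of fun i j => fderivWithin ℝ (fun y => B y i j) D x η).trace -
      ((A x)⁻¹ * (Matrix.of fun i j => fderivWithin ℝ (fun y => A y i j) D x η) *
        ((A x)⁻¹ * B x)).trace := by
  set S : Coord m → Matrix ι ι ℝ := fun y => (A y)⁻¹ * B y with hSdef
  set a : Matrix ι ι ℝ := Matrix.of fun i j => fderivWithin ℝ (fun y => A y i j) D x η with ha
  set b : Matrix ι ι ℝ := Matrix.of fun i j => fderivWithin ℝ (fun y => B y i j) D x η with hb
  set s : Matrix ι ι ℝ := Matrix.of fun i j => fderivWithin ℝ (fun y => S y i j) D x η with hs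
  have hS : ∀ i j, DifferentiableWithinAt ℝ (fun y => S y i j) D x :=
    differentiableWithinAt_matrix_mul (differentiableWithinAt_matrix_inv hA (h0 x hx)) hB
  -- Differentiating `A S = B` for `S = A⁻¹ B` avoids a formula for the derivative of the inverse
  -- matrix.
  have key : a * S x + A x * s = b := by
    ext i j
    have h1 : fderivWithin ℝ (fun y => B y i j) D x =
        fderivWithin ℝ (fun y => ∑ k, A y i k * S y k j) D x := by
      have : ∀ y ∈ D, B y i j = ∑ k, A y i k * S y k j := fun y hy => by
        rw [← Matrix.mul_apply, hSdef]
        simp only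
        rw [Matrix.mul_nonsing_inv_cancel_left _ _ (isUnit_iff_ne_zero.2 (h0 y hy))]
      exact fderivWithin_congr this (this x hx)
    simp only [hb, Matrix.of_apply, h1]
    rw [fderivWithin_fun_sum (A := fun k y => A y i k * S y k j) hD
      fun k _ => (hA i k).mul (hS k j)]
    simp only [Matrix.add_apply, Matrix.mul_apply, sum_apply]
    rw [← Finset.sum_add_distrib]
    refine Finset.sum_congr rfl fun k _ => ?_
    rw [fderivWithin_fun_mul hD (hA i k) (hS k j)]
    simp [ha, hs]
    ring
  have h2 : s = (A x)⁻¹ * b - (A x)⁻¹ * a * S x := by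
    rw [← key, Matrix.mul_add, Matrix.nonsing_inv_mul_cancel_left _ _
      (isUnit_iff_ne_zero.2 (h0 x hx)), Matrix.mul_assoc]
    simp
  have h3 : fderivWithin ℝ (fun y => (S y).trace) D x η = s.trace := by
    simp only [Matrix.trace, Matrix.diag_apply]
    rw [fderivWithin_fun_sum hD fun k _ => hS k k]
    simp [hs]
  rw [h3, h2, Matrix.trace_sub]

/-! ### Orthonormal frames -/

/-- A linear frame given by the columns of a matrix. -/
noncomputable def colVec (F : Matrix (Fin m) (Fin m) ℝ) (α : Fin m) : Coord m :=
  ∑ i, F i α • EuclideanSpace.single i 1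

theorem transpose_mul_bilin_mul (F : Matrix (Fin m) (Fin m) ℝ)
    (c : Coord m →L[ℝ] Coord m →L[ℝ] ℝ) :
    F.transpose * (Matrix.of fun i j => c (EuclideanSpace.single i 1) (EuclideanSpace.single j 1)) *
      F = Matrix.of fun α β => c (colVec F α) (colVec F β) := by
  ext α β
  simp only [Matrix.mul_apply, Matrix.of_apply, Matrix.transpose_apply, colVec, map_sum, map_smul,
    sum_apply, smul_apply, smul_eq_mul]
  simp only [Finset.mul_sum, Finset.sum_mul]
  refine Finset.sum_congr rfl fun j _ => Finset.sum_congr rfl fun i _ => by ring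

/-- A positive definite matrix factors as `g = Bᵀ B`, and `F = B⁻¹` works; its columns are a
`g`-orthonormal frame. -/
theorem exists_transpose_mul_mul_eq_one {g : Matrix (Fin m) (Fin m) ℝ} (hg : g.PosDef) :
    ∃ F : Matrix (Fin m) (Fin m) ℝ, F.transpose * g * F = 1 ∧ g⁻¹ = F * F.transpose := by
  obtain ⟨B, rfl⟩ : ∃ B : Matrix (Fin m) (Fin m) ℝ, g = B.conjTranspose * B := by
    open scoped MatrixOrder in
    exact CStarAlgebra.nonneg_iff_eq_star_mul_self.1 hg.posSemidef.nonneg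
  have hB : IsUnit B.det := by
    have h := (Matrix.isUnit_iff_isUnit_det _).1 hg.isUnit
    rw [Matrix.det_mul] at h
    exact isUnit_of_mul_isUnit_right h
  refine ⟨B⁻¹, ?_, ?_⟩
  · rw [Matrix.conjTranspose_eq_transpose_of_trivial, Matrix.transpose_nonsing_inv,
      Matrix.mul_assoc, Matrix.mul_assoc, Matrix.mul_nonsing_inv _ hB, Matrix.mul_one,
      Matrix.nonsing_inv_mul _ (by rwa [Matrix.det_transpose])]
  · rw [Matrix.mul_inv_rev, Matrix.conjTranspose_eq_transpose_of_trivial,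
      Matrix.transpose_nonsing_inv]

/-- Orthonormal vectors of Minkowski space together with a timelike unit normal span. -/
theorem eq_sum_of_orthonormal {e : Fin m → Mink m} {n : Mink m}
    (he : ∀ i j, mink (e i) (e j) = if i = j then 1 else 0) (hn : mink n n = -1)
    (hne : ∀ i, mink n (e i) = 0) (Y : Mink m) :
    Y = ∑ i, mink Y (e i) • e i - mink Y n • n := by
  let Φ : Mink m →ₗ[ℝ] Mink m :=
    { toFun := fun z => ∑ i, z.2 i • e i + z.1 • n
      map_add' := fun z w => by
        simp only [Prod.snd_add, Prod.fst_add, PiLp.add_apply, add_smul, Finset.sum_add_distrib]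
        abel
      map_smul' := fun a z => by
        simp [mul_smul, Finset.smul_sum] }
  let Ψ : Mink m →ₗ[ℝ] Mink m :=
    { toFun := fun z => (-mink z n, WithLp.toLp 2 fun i => mink z (e i))
      map_add' := fun z w => by
        ext <;> simp [mink_add_left, add_comm]
      map_smul' := fun a z => by
        ext <;> simp [mink_smul_left] }
  -- A one-sided inverse of an endomorphism in finite dimension is two-sided, so `Φ (Ψ Y) = Y`: this
  -- replaces a dimension count.
  have h1 : Ψ * Φ = 1 := by
    refine LinearMap.ext fun z => ?_
    have hz1 : mink (Φ z) n = -z.1 := by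
      simp [Φ, mink_add_left, mink_sum_left, mink_smul_left, hn, mink_comm (e _) n, hne]
    have hz2 : ∀ i, mink (Φ z) (e i) = z.2 i := fun i => by
      simp [Φ, mink_add_left, mink_sum_left, mink_smul_left, he, hne]
    show Ψ (Φ z) = z
    ext i
    · simp [Ψ, hz1]
    · simp [Ψ, hz2]
  have h2 : Φ (Ψ Y) = Y := by
    have := LinearMap.congr_fun (mul_eq_one_comm.1 h1) Y
    simpa using this
  conv_lhs => rw [← h2]
  simp [Φ, Ψ, sub_eq_add_neg]

/-- The expansion in the frame gives `n' = a n`; normalization forces `a² = 1` and time orientation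
forces `a > 0`. -/
theorem eq_of_unit_normal {e : Fin m → Mink m} {n n' : Mink m}
    (he : ∀ i j, mink (e i) (e j) = if i = j then 1 else 0) (hn : mink n n = -1)
    (hne : ∀ i, mink n (e i) = 0) (hn' : mink n' n' = -1)
    (hne' : ∀ i, mink n' (e i) = 0) (h0 : mink n (1, 0) < 0) (h0' : mink n' (1, 0) < 0) :
    n' = n := by
  have h := eq_sum_of_orthonormal he hn hne n'
  simp only [hne', zero_smul, Finset.sum_const_zero, zero_sub, ← neg_smul] at h
  set a := -mink n' n
  rw [h, mink_smul_left] at h0'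
  have h1 : a ^ 2 = 1 := by
    rw [h, mink_smul_left, mink_smul_right, hn] at hn'
    linarith
  have h2 : 0 < a := by nlinarith
  have h3 : a = 1 := by nlinarith
  rw [h, h3, one_smul]

/-! ### Spacelike hypersurfaces with a normal field -/

/-- `n` is a `C²` field of timelike future unit normals along the spacelike `C³` hypersurface `X`,
both being defined over a convex set with nonempty interior. -/
structure IsNormalField (D : Set (Coord m)) (X n : Coord m → Mink m) : Prop where
  convex : Convex ℝ D
  nonempty_interior : (interior D).Nonempty
  contDiffOn : ContDiffOn ℝ 3 X D
  contDiffOn_normal : ContDiffOn ℝ 2 n D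
  spacelike : IsSpacelike D X
  mink_self : ∀ x ∈ D, mink (n x) (n x) = -1
  future : ∀ x ∈ D, mink (n x) (1, 0) < 0
  orthogonal : ∀ x ∈ D, ∀ ζ, mink (n x) (fderivWithin ℝ X D x ζ) = 0

/-- The matrix `⟨∂ᵢn, ∂ⱼX⟩` of the second fundamental form. -/
noncomputable def shapeMatrix (D : Set (Coord m)) (X n : Coord m → Mink m) (x : Coord m) :
    Matrix (Fin m) (Fin m) ℝ :=
  Matrix.of fun i j => mink (fderivWithin ℝ n D x (EuclideanSpace.single i 1))
    (fderivWithin ℝ X D x (EuclideanSpace.single j 1))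

namespace IsNormalField

variable {X n : Coord m → Mink m} {x : Coord m}

theorem uniqueDiffOn (H : IsNormalField D X n) : UniqueDiffOn ℝ D :=
  uniqueDiffOn_convex H.convex H.nonempty_interior

theorem contDiffOn_two (H : IsNormalField D X n) : ContDiffOn ℝ 2 X D :=
  H.contDiffOn.of_le (by norm_num)

theorem differentiableWithinAt (H : IsNormalField D X n) (hx : x ∈ D) :
    DifferentiableWithinAt ℝ X D x :=
  H.contDiffOn.differentiableOn (by norm_num) x hx

theorem differentiableWithinAt_normal (H : IsNormalField D X n) (hx : x ∈ D) :
    DifferentiableWithinAt ℝ n D x :=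
  H.contDiffOn_normal.differentiableOn (by norm_num) x hx

theorem differentiableWithinAt_deriv (H : IsNormalField D X n) (hx : x ∈ D) (ζ : Coord m) :
    DifferentiableWithinAt ℝ (fun y => fderivWithin ℝ X D y ζ) D x :=
  differentiableWithinAt_fderivWithin_apply H.uniqueDiffOn H.contDiffOn_two hx ζ

theorem differentiableWithinAt_normal_deriv (H : IsNormalField D X n) (hx : x ∈ D) (ζ : Coord m) :
    DifferentiableWithinAt ℝ (fun y => fderivWithin ℝ n D y ζ) D x :=
  differentiableWithinAt_fderivWithin_apply H.uniqueDiffOn H.contDiffOn_normal hx ζ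

theorem fderivWithin_deriv (H : IsNormalField D X n) (hx : x ∈ D) (ζ η : Coord m) :
    fderivWithin ℝ (fun y => fderivWithin ℝ X D y η) D x ζ = hessWithin D X x ζ η :=
  fderivWithin_fderivWithin_apply H.uniqueDiffOn H.contDiffOn_two hx ζ η

theorem fderivWithin_normal_deriv (H : IsNormalField D X n) (hx : x ∈ D) (ζ η : Coord m) :
    fderivWithin ℝ (fun y => fderivWithin ℝ n D y η) D x ζ = hessWithin D n x ζ η :=
  fderivWithin_fderivWithin_apply H.uniqueDiffOn H.contDiffOn_normal hx ζ η

theorem hess_comm (H : IsNormalField D X n) (hx : x ∈ D) (ζ η : Coord m) :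
    hessWithin D X x ζ η = hessWithin D X x η ζ :=
  hessWithin_comm H.convex H.nonempty_interior H.contDiffOn_two hx ζ η

theorem normal_hess_comm (H : IsNormalField D X n) (hx : x ∈ D) (ζ η : Coord m) :
    hessWithin D n x ζ η = hessWithin D n x η ζ :=
  hessWithin_comm H.convex H.nonempty_interior H.contDiffOn_normal hx ζ η

theorem mink_deriv_normal (H : IsNormalField D X n) (hx : x ∈ D) (ζ : Coord m) :
    mink (n x) (fderivWithin ℝ n D x ζ) = 0 := by
  have h := fderivWithin_mink (H.uniqueDiffOn x hx) (H.differentiableWithinAt_normal hx)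
    (H.differentiableWithinAt_normal hx) ζ
  rw [fderivWithin_eq_zero_of_const H.mink_self hx, mink_comm _ (n x)] at h
  simp only [zero_apply] at h
  linarith

/-- The Weingarten equation. -/
theorem weingarten (H : IsNormalField D X n) (hx : x ∈ D) (ζ η : Coord m) :
    mink (fderivWithin ℝ n D x ζ) (fderivWithin ℝ X D x η) =
      -mink (n x) (hessWithin D X x ζ η) := by
  have h := fderivWithin_mink (H.uniqueDiffOn x hx) (H.differentiableWithinAt_normal hx)
    (H.differentiableWithinAt_deriv hx η) ζ
  rw [fderivWithin_eq_zero_of_const (fun y hy => H.orthogonal y hy η) hx,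
    H.fderivWithin_deriv hx] at h
  simp only [zero_apply] at h
  linarith

/-- The second fundamental form is symmetric. -/
theorem second_fund_comm (H : IsNormalField D X n) (hx : x ∈ D) (ζ η : Coord m) :
    mink (fderivWithin ℝ n D x ζ) (fderivWithin ℝ X D x η) =
      mink (fderivWithin ℝ n D x η) (fderivWithin ℝ X D x ζ) := by
  rw [H.weingarten hx, H.weingarten hx, H.hess_comm hx]

/-- Differentiate `⟨n, dn η⟩ = 0`. This is the source of the term `ρ|A|²` in the trace of the
Hessian of `testFn`. -/
theorem mink_normal_hess (H : IsNormalField D X n) (hx : x ∈ D) (ζ η : Coord m) :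
    mink (n x) (hessWithin D n x ζ η) =
      -mink (fderivWithin ℝ n D x ζ) (fderivWithin ℝ n D x η) := by
  have h := fderivWithin_mink (H.uniqueDiffOn x hx) (H.differentiableWithinAt_normal hx)
    (H.differentiableWithinAt_normal_deriv hx η) ζ
  rw [fderivWithin_eq_zero_of_const (fun y hy => H.mink_deriv_normal hy η) hx,
    H.fderivWithin_normal_deriv hx] at h
  simp only [zero_apply] at h
  linarith

/-- The derivative of the second fundamental form. -/
theorem fderivWithin_second_fund (H : IsNormalField D X n) (hx : x ∈ D) (η ζ ζ' : Coord m) :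
    fderivWithin ℝ (fun y => mink (fderivWithin ℝ n D y ζ) (fderivWithin ℝ X D y ζ')) D x η =
      mink (hessWithin D n x η ζ) (fderivWithin ℝ X D x ζ') +
        mink (fderivWithin ℝ n D x ζ) (hessWithin D X x η ζ') := by
  rw [fderivWithin_mink (H.uniqueDiffOn x hx) (H.differentiableWithinAt_normal_deriv hx ζ)
    (H.differentiableWithinAt_deriv hx ζ'), H.fderivWithin_deriv hx,
    H.fderivWithin_normal_deriv hx]

/-- The Codazzi equation. -/
theorem codazzi (H : IsNormalField D X n) (hx : x ∈ D) (η ζ ζ' : Coord m) :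
    mink (hessWithin D n x η ζ) (fderivWithin ℝ X D x ζ') +
        mink (fderivWithin ℝ n D x ζ) (hessWithin D X x η ζ') =
      mink (hessWithin D n x η ζ') (fderivWithin ℝ X D x ζ) +
        mink (fderivWithin ℝ n D x ζ') (hessWithin D X x η ζ) := by
  -- In flat space the Codazzi equation is the derivative of the symmetry of `II`, so no third
  -- derivative of `X` is commuted.
  rw [← H.fderivWithin_second_fund hx, ← H.fderivWithin_second_fund hx,
    fderivWithin_congr (fun y hy => H.second_fund_comm hy ζ ζ') (H.second_fund_comm hx ζ ζ')]

/-- An orthonormal frame at `x`, together with the matrix of its components. -/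
theorem exists_frame (H : IsNormalField D X n) (hx : x ∈ D) :
    ∃ F : Matrix (Fin m) (Fin m) ℝ, (inducedMetric D X x)⁻¹ = F * F.transpose ∧
      ∀ i j, mink (fderivWithin ℝ X D x (colVec F i)) (fderivWithin ℝ X D x (colVec F j)) =
        if i = j then 1 else 0 := by
  obtain ⟨F, hF, hF'⟩ := exists_transpose_mul_mul_eq_one (H.spacelike x hx)
  refine ⟨F, hF', fun i j => ?_⟩
  have h := transpose_mul_bilin_mul F
    ((minkL m).bilinearComp (fderivWithin ℝ X D x) (fderivWithin ℝ X D x))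
  simp only [ContinuousLinearMap.bilinearComp_apply, minkL_apply] at h
  have h2 := congrFun (congrFun (hF.symm.trans h) i) j
  rw [Matrix.one_apply] at h2
  exact h2.symm

/-- The choice made by `Classical.epsilon` is pinned down by uniqueness of the future unit normal,
so every later computation can use the explicit field `n`. -/
theorem unitNormal_eq (H : IsNormalField D X n) (hx : x ∈ D) : unitNormal D X x = n x := by
  obtain ⟨F, -, hF⟩ := H.exists_frame hx
  have h1 : IsFutureUnitNormal D X x (n x) :=
    ⟨H.mink_self x hx, H.future x hx, fun i => H.orthogonal x hx _⟩
  obtain ⟨h2, h3, h4⟩ := Classical.epsilon_spec ⟨n x, h1⟩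
  refine eq_of_unit_normal hF (H.mink_self x hx) (fun i => H.orthogonal x hx _) h2 (fun i => ?_)
    (H.future x hx) h3
  simp only [colVec, map_sum, map_smul, mink_sum_right, mink_smul_right]
  exact Finset.sum_eq_zero fun i _ => by
    exact mul_eq_zero_of_right _ (h4 i)

theorem secondFundForm_eq (H : IsNormalField D X n) (hx : x ∈ D) :
    secondFundForm D X x = shapeMatrix D X n x := by
  ext i j
  rw [shapeMatrix, Matrix.of_apply, H.weingarten hx, secondFundForm, Matrix.of_apply, H.unitNormal_eq hx,
    mink_comm]
  simp only [partialWithin]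
  rw [H.fderivWithin_deriv hx]

theorem meanCurvature_eq_trace (H : IsNormalField D X n) (hx : x ∈ D) :
    meanCurvature D X x = (1 / (m : ℝ)) * ((inducedMetric D X x)⁻¹ * shapeMatrix D X n x).trace := by
  rw [meanCurvature, H.secondFundForm_eq hx]

theorem det_ne_zero (H : IsNormalField D X n) (hx : x ∈ D) : (inducedMetric D X x).det ≠ 0 :=
  ((Matrix.isUnit_iff_isUnit_det _).1 (H.spacelike x hx).isUnit).ne_zero

theorem differentiableWithinAt_metric (H : IsNormalField D X n) (hx : x ∈ D) (i j : Fin m) :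
    DifferentiableWithinAt ℝ (fun y => inducedMetric D X y i j) D x :=
  differentiableWithinAt_mink (H.differentiableWithinAt_deriv hx _) (H.differentiableWithinAt_deriv hx _)

theorem differentiableWithinAt_shapeMatrix (H : IsNormalField D X n) (hx : x ∈ D) (i j : Fin m) :
    DifferentiableWithinAt ℝ (fun y => shapeMatrix D X n y i j) D x :=
  differentiableWithinAt_mink (H.differentiableWithinAt_normal_deriv hx _)
    (H.differentiableWithinAt_deriv hx _)

/-- Gives continuity of `H` up to the boundary, through which the bound `|H| ≤ Λ` reaches the
boundary sphere. -/
theorem differentiableWithinAt_meanCurvature (H : IsNormalField D X n) (hx : x ∈ D) :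
    DifferentiableWithinAt ℝ (meanCurvature D X) D x := by
  refine DifferentiableWithinAt.congr ?_ (fun y hy => H.meanCurvature_eq_trace hy)
    (H.meanCurvature_eq_trace hx)
  exact (differentiableWithinAt_trace_inv_mul (H.differentiableWithinAt_metric hx)
    (H.differentiableWithinAt_shapeMatrix hx) (H.det_ne_zero hx)).const_mul _

end IsNormalField

/-! ### Traces, the mean curvature and its derivative in an orthonormal frame. -/

theorem trace_gram_mul (F : Matrix (Fin m) (Fin m) ℝ) (c : Coord m →L[ℝ] Coord m →L[ℝ] ℝ) :
    (F * F.transpose * Matrix.of fun i j => c (EuclideanSpace.single i 1)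
      (EuclideanSpace.single j 1)).trace = ∑ α, c (colVec F α) (colVec F α) := by
  rw [Matrix.mul_assoc, Matrix.trace_mul_comm, transpose_mul_bilin_mul]
  simp [Matrix.trace]

/-- Cyclicity of the trace moves the outer `F` to the right, and each factor becomes the matrix of
its form in the frame. It serves the term `tr (g⁻¹ g' g⁻¹ II)` of the derivative of `H`. -/
theorem trace_gram_mul_gram_mul (F : Matrix (Fin m) (Fin m) ℝ)
    (b c : Coord m →L[ℝ] Coord m →L[ℝ] ℝ) :
    (F * F.transpose * (Matrix.of fun i j => b (EuclideanSpace.single i 1)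
      (EuclideanSpace.single j 1)) * (F * F.transpose * Matrix.of fun i j =>
        c (EuclideanSpace.single i 1) (EuclideanSpace.single j 1))).trace =
      ∑ α, ∑ β, b (colVec F α) (colVec F β) * c (colVec F β) (colVec F α) := by
  rw [Matrix.mul_assoc, Matrix.mul_assoc, Matrix.trace_mul_comm]
  have : F.transpose * ((Matrix.of fun i j => b (EuclideanSpace.single i 1)
      (EuclideanSpace.single j 1)) * (F * F.transpose * Matrix.of fun i j =>
        c (EuclideanSpace.single i 1) (EuclideanSpace.single j 1))) * F =
      (Matrix.of fun α β => b (colVec F α) (colVec F β)) *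
        Matrix.of fun α β => c (colVec F α) (colVec F β) := by
    rw [← transpose_mul_bilin_mul, ← transpose_mul_bilin_mul]
    simp only [Matrix.mul_assoc]
  rw [this]
  simp [Matrix.trace, Matrix.mul_apply]

namespace IsNormalField

variable {X n : Coord m → Mink m} {x : Coord m}

theorem meanCurvature_eq_sum (H : IsNormalField D X n) (hx : x ∈ D) (hm : (m : ℝ) ≠ 0)
    {F : Matrix (Fin m) (Fin m) ℝ} (hF : (inducedMetric D X x)⁻¹ = F * F.transpose) :
    m * meanCurvature D X x =
      ∑ α, mink (fderivWithin ℝ n D x (colVec F α)) (fderivWithin ℝ X D x (colVec F α)) := by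
  rw [H.meanCurvature_eq_trace hx, hF]
  have h := trace_gram_mul F
    ((minkL m).bilinearComp (fderivWithin ℝ n D x) (fderivWithin ℝ X D x))
  simp only [ContinuousLinearMap.bilinearComp_apply, minkL_apply] at h
  rw [shapeMatrix, h]
  field_simp

/-- The derivative of the mean curvature in an orthonormal frame. -/
theorem fderivWithin_meanCurvature (H : IsNormalField D X n) (hx : x ∈ D) (hm : (m : ℝ) ≠ 0)
    {F : Matrix (Fin m) (Fin m) ℝ} (hF : (inducedMetric D X x)⁻¹ = F * F.transpose)
    (η : Coord m) :
    m * fderivWithin ℝ (meanCurvature D X) D x η =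
      ∑ α, (mink (hessWithin D n x η (colVec F α)) (fderivWithin ℝ X D x (colVec F α)) +
        mink (fderivWithin ℝ n D x (colVec F α)) (hessWithin D X x η (colVec F α))) -
      ∑ α, ∑ β, (mink (hessWithin D X x η (colVec F α)) (fderivWithin ℝ X D x (colVec F β)) +
        mink (fderivWithin ℝ X D x (colVec F α)) (hessWithin D X x η (colVec F β))) *
        mink (fderivWithin ℝ n D x (colVec F β)) (fderivWithin ℝ X D x (colVec F α)) := by
  have hdiff := differentiableWithinAt_trace_inv_mul (H.differentiableWithinAt_metric hx)
    (H.differentiableWithinAt_shapeMatrix hx) (H.det_ne_zero hx)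
  have h1 : fderivWithin ℝ (meanCurvature D X) D x η = (1 / (m : ℝ)) *
      fderivWithin ℝ (fun y => ((inducedMetric D X y)⁻¹ * shapeMatrix D X n y).trace) D x η := by
    rw [fderivWithin_congr (fun y hy => H.meanCurvature_eq_trace hy)
      (H.meanCurvature_eq_trace hx), fderivWithin_const_mul (H.uniqueDiffOn x hx) hdiff]
    simp
  rw [h1, fderivWithin_trace_inv_mul (H.uniqueDiffOn x hx) hx
    (H.differentiableWithinAt_metric hx)
    (H.differentiableWithinAt_shapeMatrix hx) (fun y hy => H.det_ne_zero hy), hF]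
  have h2 := trace_gram_mul F
    ((minkL m).bilinearComp (fderivWithin ℝ (fderivWithin ℝ n D) D x η) (fderivWithin ℝ X D x) +
      (minkL m).bilinearComp (fderivWithin ℝ n D x) (fderivWithin ℝ (fderivWithin ℝ X D) D x η))
  have h3 := trace_gram_mul_gram_mul F
    ((minkL m).bilinearComp (fderivWithin ℝ (fderivWithin ℝ X D) D x η) (fderivWithin ℝ X D x) +
      (minkL m).bilinearComp (fderivWithin ℝ X D x) (fderivWithin ℝ (fderivWithin ℝ X D) D x η))
    ((minkL m).bilinearComp (fderivWithin ℝ n D x) (fderivWithin ℝ X D x))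
  simp only [add_apply, ContinuousLinearMap.bilinearComp_apply, minkL_apply] at h2 h3
  have h4 : ∀ i j, fderivWithin ℝ (fun y => inducedMetric D X y i j) D x η =
      mink (hessWithin D X x η (EuclideanSpace.single i 1))
        (fderivWithin ℝ X D x (EuclideanSpace.single j 1)) +
      mink (fderivWithin ℝ X D x (EuclideanSpace.single i 1))
        (hessWithin D X x η (EuclideanSpace.single j 1)) := fun i j => by
    rw [← H.fderivWithin_deriv hx, ← H.fderivWithin_deriv hx, ← fderivWithin_mink
      (H.uniqueDiffOn x hx) (H.differentiableWithinAt_deriv hx _)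
      (H.differentiableWithinAt_deriv hx _)]
    rfl
  have h5 : ∀ i j, fderivWithin ℝ (fun y => shapeMatrix D X n y i j) D x η =
      mink (hessWithin D n x η (EuclideanSpace.single i 1))
        (fderivWithin ℝ X D x (EuclideanSpace.single j 1)) +
      mink (fderivWithin ℝ n D x (EuclideanSpace.single i 1))
        (hessWithin D X x η (EuclideanSpace.single j 1)) := fun i j =>
    H.fderivWithin_second_fund hx _ _ _
  simp only [h4, h5]
  simp only [hessWithin, shapeMatrix]
  rw [h2, h3, ← mul_assoc, mul_one_div_cancel hm, one_mul]

/-- The gradient norm in an orthonormal frame. -/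
theorem gradNorm_eq {F : Matrix (Fin m) (Fin m) ℝ} {φ : Coord m → ℝ}
    (hF : (inducedMetric D X x)⁻¹ = F * F.transpose) :
    gradNorm D X φ x = Real.sqrt (∑ α, fderivWithin ℝ φ D x (colVec F α) ^ 2) := by
  rw [gradNorm, hF]
  congr 1
  simp only [Matrix.mul_apply, Matrix.transpose_apply, colVec, map_sum, map_smul, smul_eq_mul,
    partialWithin, Finset.sum_mul, sq, Finset.mul_sum]
  rw [Finset.sum_comm_cycle]
  refine Finset.sum_congr rfl fun α _ => ?_
  rw [Finset.sum_comm]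
  exact Finset.sum_congr rfl fun i _ => Finset.sum_congr rfl fun j _ => by ring

end IsNormalField

/-! ### Second derivative test -/

/-- A positive second derivative would make `t` a local minimum too, hence `g` locally constant with
vanishing second derivative. -/
theorem deriv_deriv_nonpos_of_isLocalMax {g : ℝ → ℝ} {t : ℝ} (h : IsLocalMax g t)
    (hc : ContinuousAt g t) : deriv (deriv g) t ≤ 0 := by
  by_contra! hpos
  have hmin := isLocalMin_of_deriv_deriv_pos hpos h.deriv_eq_zero hc
  have hconst : g =ᶠ[𝓝 t] fun _ => g t := by
    filter_upwards [h, hmin] with s hs hs'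
    exact le_antisymm hs hs'
  have h1 : deriv g =ᶠ[𝓝 t] fun _ => 0 := by
    have := hconst.deriv
    simpa using this
  rw [h1.deriv_eq] at hpos
  simp at hpos

/-- Restriction to the line `x + tζ`, which stays in the interior for small `t`, reduces this to one
variable. -/
theorem hessWithin_nonpos_of_isLocalMax (hD : UniqueDiffOn ℝ D) {G : Coord m → ℝ}
    (hG : ContDiffOn ℝ 2 G D) {x : Coord m} (hx : x ∈ interior D) (hmax : IsLocalMax G x)
    (ζ : Coord m) : hessWithin D G x ζ ζ ≤ 0 := by
  set γ : ℝ → Coord m := fun t => x + t • ζ with hγ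
  have hγ0 : γ 0 = x := by simp [hγ]
  have hγd : ∀ t, HasDerivAt γ ζ t := fun t => by
    simpa [hγ] using ((hasDerivAt_id' t).smul_const ζ).const_add x
  have hγc : Continuous γ := by fun_prop
  have hint : ∀ᶠ t in 𝓝 (0 : ℝ), γ t ∈ interior D :=
    hγc.continuousAt.eventually_mem (by rw [hγ0]; exact isOpen_interior.mem_nhds hx)
  have hd : ∀ t, γ t ∈ interior D →
      HasDerivAt (fun t => G (γ t)) (fderivWithin ℝ G D (γ t) ζ) t := fun t ht => by
    have hn : D ∈ 𝓝 (γ t) := mem_interior_iff_mem_nhds.1 ht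
    have h1 : HasFDerivAt G (fderivWithin ℝ G D (γ t)) (γ t) :=
      ((hG.differentiableOn (by norm_num) _ (interior_subset ht)).hasFDerivWithinAt).hasFDerivAt hn
    exact h1.comp_hasDerivAt t (hγd t)
  have hd1 : deriv (fun t => G (γ t)) =ᶠ[𝓝 0] fun t => fderivWithin ℝ G D (γ t) ζ := by
    filter_upwards [hint] with t ht
    exact (hd t ht).deriv
  have hn : D ∈ 𝓝 (γ 0) := by rw [hγ0]; exact mem_interior_iff_mem_nhds.1 hx
  have hxD := interior_subset hx
  have hd2 : HasDerivAt (fun t => fderivWithin ℝ G D (γ t) ζ) (hessWithin D G x ζ ζ) 0 := by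
    have h1 := (differentiableWithinAt_fderivWithin_apply hD hG hxD ζ).hasFDerivWithinAt
    rw [← hγ0] at h1
    have h2 := (h1.hasFDerivAt hn).comp_hasDerivAt 0 (hγd 0)
    rw [hγ0, fderivWithin_fderivWithin_apply hD hG hxD] at h2
    exact h2
  have hmax' : IsLocalMax (fun t => G (γ t)) 0 := by
    have : IsLocalMax G (γ 0) := by rwa [hγ0]
    exact this.comp_continuous hγc.continuousAt
  have := deriv_deriv_nonpos_of_isLocalMax hmax'
    (hd 0 (by rwa [hγ0])).continuousAt
  rwa [hd1.deriv_eq, hd2.deriv] at this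

/-! ### The test function -/

/-- The support function `-⟨X - o, n⟩`. -/
noncomputable def supportFn (o : Mink m) (X n : Coord m → Mink m) (x : Coord m) : ℝ :=
  -mink (X x - o) (n x)

/-- The logarithm of the support function, plus `k` times half the squared distance to `o`. -/
noncomputable def testFn (o : Mink m) (X n : Coord m → Mink m) (k : ℝ) (x : Coord m) : ℝ :=
  Real.log (supportFn o X n x) + k * (-mink (X x - o) (X x - o) / 2)

theorem contDiffOn_mink {k : WithTop ℕ∞} {f g : Coord m → Mink m} (hf : ContDiffOn ℝ k f D)
    (hg : ContDiffOn ℝ k g D) : ContDiffOn ℝ k (fun y => mink (f y) (g y)) D := by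
  simp only [← minkL_apply]
  exact ((minkL m).contDiff.comp_contDiffOn hf).clm_apply hg

namespace IsNormalField

variable {X n : Coord m → Mink m} {o : Mink m} {x : Coord m} {k : ℝ}

theorem contDiffOn_supportFn (H : IsNormalField D X n) (o : Mink m) :
    ContDiffOn ℝ 2 (supportFn o X n) D :=
  (contDiffOn_mink (H.contDiffOn_two.sub contDiffOn_const) H.contDiffOn_normal).neg

theorem contDiffOn_testFn (H : IsNormalField D X n) (hpos : ∀ y ∈ D, 0 < supportFn o X n y) :
    ContDiffOn ℝ 2 (testFn o X n k) D := by
  have h1 := contDiffOn_mink (H.contDiffOn_two.sub (contDiffOn_const (c := o)))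
    (H.contDiffOn_two.sub (contDiffOn_const (c := o)))
  exact ((H.contDiffOn_supportFn o).log fun y hy => (hpos y hy).ne').add
    (contDiffOn_const.mul (h1.neg.div_const 2))

theorem fderivWithin_supportFn (H : IsNormalField D X n) (hx : x ∈ D) (ζ : Coord m) :
    fderivWithin ℝ (supportFn o X n) D x ζ = -mink (X x - o) (fderivWithin ℝ n D x ζ) := by
  have hd := H.uniqueDiffOn x hx
  have h := fderivWithin_mink hd ((H.differentiableWithinAt hx).sub_const o)
    (H.differentiableWithinAt_normal hx) ζ
  rw [fderivWithin_sub_const, mink_comm _ (n x), H.orthogonal x hx, zero_add] at h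
  rw [← h]
  show fderivWithin ℝ (fun y => -mink (X y - o) (n y)) D x ζ = _
  rw [fderivWithin_fun_neg hd]
  rfl

theorem fderivWithin_testFn (H : IsNormalField D X n) (hpos : ∀ y ∈ D, 0 < supportFn o X n y)
    (hx : x ∈ D) (ζ : Coord m) :
    fderivWithin ℝ (testFn o X n k) D x ζ =
      -mink (X x - o) (fderivWithin ℝ n D x ζ) / supportFn o X n x -
        k * mink (X x - o) (fderivWithin ℝ X D x ζ) := by
  have hd := H.uniqueDiffOn x hx
  have hdY := (H.differentiableWithinAt hx).sub_const o
  have hs : DifferentiableWithinAt ℝ (supportFn o X n) D x :=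
    (H.contDiffOn_supportFn o).differentiableOn (by norm_num) x hx
  have h1 := (hs.hasFDerivWithinAt.log (hpos x hx).ne').add
    ((((differentiableWithinAt_mink hdY hdY).hasFDerivWithinAt.neg).mul_const (2⁻¹ : ℝ)).const_mul k)
  have h2 : HasFDerivWithinAt (testFn o X n k) _ D x := h1
  rw [h2.fderivWithin hd]
  simp only [add_apply, smul_apply, smul_eq_mul, neg_apply]
  rw [H.fderivWithin_supportFn hx, fderivWithin_mink hd hdY hdY, fderivWithin_sub_const,
    mink_comm _ (X x - o)]
  ring

theorem hessWithin_testFn (H : IsNormalField D X n) (hpos : ∀ y ∈ D, 0 < supportFn o X n y)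
    (hx : x ∈ D) (ζ : Coord m) :
    hessWithin D (testFn o X n k) x ζ ζ =
      -(mink (fderivWithin ℝ X D x ζ) (fderivWithin ℝ n D x ζ) +
        mink (X x - o) (hessWithin D n x ζ ζ)) / supportFn o X n x -
      (mink (X x - o) (fderivWithin ℝ n D x ζ)) ^ 2 / supportFn o X n x ^ 2 -
      k * (mink (fderivWithin ℝ X D x ζ) (fderivWithin ℝ X D x ζ) +
        mink (X x - o) (hessWithin D X x ζ ζ)) := by
  have hd := H.uniqueDiffOn x hx
  have hdY := (H.differentiableWithinAt hx).sub_const o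
  have hs : DifferentiableWithinAt ℝ (supportFn o X n) D x :=
    (H.contDiffOn_supportFn o).differentiableOn (by norm_num) x hx
  rw [← fderivWithin_fderivWithin_apply H.uniqueDiffOn (H.contDiffOn_testFn hpos) hx,
    fderivWithin_congr (fun y hy => H.fderivWithin_testFn hpos hy ζ)
      (H.fderivWithin_testFn hpos hx ζ)]
  have hn := differentiableWithinAt_mink hdY (H.differentiableWithinAt_normal_deriv hx ζ)
  have hX := differentiableWithinAt_mink hdY (H.differentiableWithinAt_deriv hx ζ)
  have h1 := (hn.hasFDerivWithinAt.neg.mul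
    ((hasDerivAt_inv (hpos x hx).ne').comp_hasFDerivWithinAt x hs.hasFDerivWithinAt)).sub
    (hX.hasFDerivWithinAt.const_mul k)
  have h2 : HasFDerivWithinAt (fun y => -mink (X y - o) (fderivWithin ℝ n D y ζ) /
      supportFn o X n y - k * mink (X y - o) (fderivWithin ℝ X D y ζ)) _ D x := h1
  rw [h2.fderivWithin hd]
  simp only [add_apply, sub_apply, smul_apply, smul_eq_mul, neg_apply, Function.comp]
  rw [H.fderivWithin_supportFn hx, fderivWithin_mink hd hdY (H.differentiableWithinAt_deriv hx ζ),
    fderivWithin_mink hd hdY (H.differentiableWithinAt_normal_deriv hx ζ), fderivWithin_sub_const,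
    H.fderivWithin_deriv hx, H.fderivWithin_normal_deriv hx]
  simp only [Pi.neg_apply]
  ring

end IsNormalField

/-! ### Interior maxima -/

namespace IsNormalField

variable {X n : Coord m → Mink m} {o : Mink m} {x : Coord m} {k : ℝ}

/-- At a critical point of the test function, the tangential part of the position vector is an
eigenvector of the shape operator. -/
theorem deriv_normal_eq_of_critical (H : IsNormalField D X n) (hx : x ∈ D)
    {F : Matrix (Fin m) (Fin m) ℝ}
    (hF : ∀ i j, mink (fderivWithin ℝ X D x (colVec F i)) (fderivWithin ℝ X D x (colVec F j)) =
      if i = j then 1 else 0) {ξ : Coord m}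
    (hξ : X x - o = fderivWithin ℝ X D x ξ + supportFn o X n x • n x)
    (hcrit : ∀ ζ, mink (X x - o) (fderivWithin ℝ n D x ζ) =
      -(k * supportFn o X n x) * mink (X x - o) (fderivWithin ℝ X D x ζ)) :
    fderivWithin ℝ n D x ξ = -(k * supportFn o X n x) • fderivWithin ℝ X D x ξ := by
  have hY : ∀ Z : Mink m, mink (n x) Z = 0 → mink (fderivWithin ℝ X D x ξ) Z = mink (X x - o) Z :=
    fun Z hZ => by rw [hξ, mink_add_left, mink_smul_left, hZ]; ring
  rw [eq_sum_of_orthonormal hF (H.mink_self x hx) (fun i => H.orthogonal x hx _)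
    (fderivWithin ℝ n D x ξ)]
  conv_rhs => rw [eq_sum_of_orthonormal hF (H.mink_self x hx) (fun i => H.orthogonal x hx _)
    (fderivWithin ℝ X D x ξ)]
  rw [mink_comm _ (n x), H.mink_deriv_normal hx, mink_comm _ (n x), H.orthogonal x hx, zero_smul,
    sub_zero, sub_zero, Finset.smul_sum]
  refine Finset.sum_congr rfl fun i _ => ?_
  rw [smul_smul, H.second_fund_comm hx, mink_comm, hY _ (H.mink_deriv_normal hx _), hcrit,
    hY _ (H.orthogonal x hx _)]

/-- The trace of the Hessian of the test function at a critical point. -/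
theorem trace_inequality (H : IsNormalField D X n) (hx : x ∈ D) (hm : (m : ℝ) ≠ 0)
    (hpos : ∀ y ∈ D, 0 < supportFn o X n y)
    {F : Matrix (Fin m) (Fin m) ℝ} (hFi : (inducedMetric D X x)⁻¹ = F * F.transpose)
    (hF : ∀ i j, mink (fderivWithin ℝ X D x (colVec F i)) (fderivWithin ℝ X D x (colVec F j)) =
      if i = j then 1 else 0) {ξ : Coord m}
    (hξ : X x - o = fderivWithin ℝ X D x ξ + supportFn o X n x • n x)
    (hcrit : ∀ ζ, mink (X x - o) (fderivWithin ℝ n D x ζ) =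
      -(k * supportFn o X n x) * mink (X x - o) (fderivWithin ℝ X D x ζ))
    (hhess : ∀ ζ, hessWithin D (testFn o X n k) x ζ ζ ≤ 0) :
    -(m * meanCurvature D X x) - m * fderivWithin ℝ (meanCurvature D X) D x ξ +
      supportFn o X n x * (∑ α, ∑ β, mink (fderivWithin ℝ n D x (colVec F α))
        (fderivWithin ℝ X D x (colVec F β)) ^ 2) -
      k ^ 2 * supportFn o X n x * (∑ α, mink (X x - o) (fderivWithin ℝ X D x (colVec F α)) ^ 2) -
      k * supportFn o X n x * m + k * supportFn o X n x ^ 2 * (m * meanCurvature D X x) ≤ 0 := by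
  set ρ := supportFn o X n x with hρdef
  have hρ : 0 < ρ := hpos x hx
  have hn := H.deriv_normal_eq_of_critical hx hF hξ hcrit
  have hexp : ∀ α, fderivWithin ℝ n D x (colVec F α) =
      ∑ β, mink (fderivWithin ℝ n D x (colVec F α)) (fderivWithin ℝ X D x (colVec F β)) •
        fderivWithin ℝ X D x (colVec F β) := fun α => by
    conv_lhs => rw [eq_sum_of_orthonormal hF (H.mink_self x hx) (fun i => H.orthogonal x hx _)
      (fderivWithin ℝ n D x (colVec F α))]
    rw [mink_comm _ (n x), H.mink_deriv_normal hx, zero_smul, sub_zero]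
  have hexp' : ∀ α (Z : Mink m), ∑ β, mink (fderivWithin ℝ n D x (colVec F α))
      (fderivWithin ℝ X D x (colVec F β)) * mink (fderivWithin ℝ X D x (colVec F β)) Z =
      mink (fderivWithin ℝ n D x (colVec F α)) Z := fun α Z => by
    conv_rhs => rw [hexp α, mink_sum_left]
    simp only [mink_smul_left]
  have hterm : ∀ α,
      -mink (fderivWithin ℝ n D x (colVec F α)) (fderivWithin ℝ X D x (colVec F α)) -
        ((mink (hessWithin D n x ξ (colVec F α)) (fderivWithin ℝ X D x (colVec F α)) +
          mink (fderivWithin ℝ n D x (colVec F α)) (hessWithin D X x ξ (colVec F α))) -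
          2 * mink (fderivWithin ℝ n D x (colVec F α)) (hessWithin D X x ξ (colVec F α))) +
        ρ * mink (fderivWithin ℝ n D x (colVec F α)) (fderivWithin ℝ n D x (colVec F α)) -
        k ^ 2 * ρ * mink (X x - o) (fderivWithin ℝ X D x (colVec F α)) ^ 2 - k * ρ +
        k * ρ ^ 2 *
          mink (fderivWithin ℝ n D x (colVec F α)) (fderivWithin ℝ X D x (colVec F α)) ≤ 0 :=
    fun α => by
    have h0 := hhess (colVec F α)
    rw [H.hessWithin_testFn hpos hx, ← hρdef, hF α α, if_pos rfl, hcrit] at h0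
    have h1 : mink (X x - o) (hessWithin D n x (colVec F α) (colVec F α)) =
        mink (fderivWithin ℝ X D x ξ) (hessWithin D n x (colVec F α) (colVec F α)) -
          ρ * mink (fderivWithin ℝ n D x (colVec F α)) (fderivWithin ℝ n D x (colVec F α)) := by
      rw [hξ, mink_add_left, mink_smul_left, H.mink_normal_hess hx]
      ring
    have h2 : mink (X x - o) (hessWithin D X x (colVec F α) (colVec F α)) =
        mink (fderivWithin ℝ X D x ξ) (hessWithin D X x (colVec F α) (colVec F α)) -
          ρ * mink (fderivWithin ℝ n D x (colVec F α)) (fderivWithin ℝ X D x (colVec F α)) := by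
      rw [hξ, mink_add_left, mink_smul_left, H.weingarten hx]
      ring
    -- Because `dn ξ = -kρ dX ξ`, Codazzi trades both terms with second derivatives in `(e_α, e_α)`
    -- for terms in `(ξ, e_α)`, which are those of the derivative of `H` along `ξ`.
    have h3 := H.codazzi hx (colVec F α) (colVec F α) ξ
    rw [hn, mink_smul_left, H.hess_comm hx (colVec F α) ξ, H.normal_hess_comm hx (colVec F α) ξ,
      mink_comm (hessWithin D n x (colVec F α) (colVec F α))] at h3
    rw [h1, h2, mink_comm (fderivWithin ℝ X D x (colVec F α)) (fderivWithin ℝ n D x _)] at h0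
    have h4 := mul_le_mul_of_nonneg_left h0 hρ.le
    rw [mul_zero] at h4
    refine le_of_eq_of_le ?_ h4
    field_simp
    linear_combination h3
  have hsum := Finset.sum_nonpos fun α (_ : α ∈ Finset.univ) => hterm α
  refine le_of_eq_of_le ?_ hsum
  have hsq : ∀ α, ∑ β, mink (fderivWithin ℝ n D x (colVec F α))
      (fderivWithin ℝ X D x (colVec F β)) ^ 2 =
      mink (fderivWithin ℝ n D x (colVec F α)) (fderivWithin ℝ n D x (colVec F α)) := fun α => by
    rw [← hexp' α]
    exact Finset.sum_congr rfl fun β _ => by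
      rw [mink_comm (fderivWithin ℝ X D x (colVec F β))]; ring
  -- The derivative of the metric is a symmetric form and `II` is symmetric, so its two halves
  -- contribute equally.
  have hdouble : ∑ α, ∑ β, (mink (hessWithin D X x ξ (colVec F α))
        (fderivWithin ℝ X D x (colVec F β)) +
        mink (fderivWithin ℝ X D x (colVec F α)) (hessWithin D X x ξ (colVec F β))) *
        mink (fderivWithin ℝ n D x (colVec F β)) (fderivWithin ℝ X D x (colVec F α)) =
      ∑ α, 2 * mink (fderivWithin ℝ n D x (colVec F α)) (hessWithin D X x ξ (colVec F α)) := by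
    simp only [add_mul, Finset.sum_add_distrib, two_mul]
    congr 1
    · refine Finset.sum_congr rfl fun α _ => ?_
      rw [← hexp' α]
      refine Finset.sum_congr rfl fun β _ => ?_
      rw [H.second_fund_comm hx, mink_comm (hessWithin D X x ξ (colVec F α)), mul_comm]
    · rw [Finset.sum_comm]
      refine Finset.sum_congr rfl fun α _ => ?_
      rw [← hexp' α]
      exact Finset.sum_congr rfl fun β _ => mul_comm _ _
  rw [H.fderivWithin_meanCurvature hx hm hFi, hdouble, H.meanCurvature_eq_sum hx hm hFi]
  simp only [hsq, Finset.sum_add_distrib, Finset.sum_sub_distrib, ← Finset.mul_sum,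
    Finset.sum_neg_distrib]
  simp only [Finset.sum_const, Finset.card_univ, Fintype.card_fin, nsmul_eq_mul]
  ring

end IsNormalField

/-- The sharpened Cauchy--Schwarz inequality for a symmetric matrix with a known eigenvector. -/
theorem sum_sq_ge_of_eigenvector {h : Fin m → Fin m → ℝ} {a : Fin m → ℝ} {κ μ : ℝ}
    (ha : 0 < ∑ α, a α ^ 2) (heig : ∀ α, ∑ β, h α β * a β = κ * a α)
    (hμ : (m - 1) * μ = ∑ α, h α α - κ) :
    κ ^ 2 + (m - 1) * μ ^ 2 ≤ ∑ α, ∑ β, h α β ^ 2 := by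
  set s := ∑ α, a α ^ 2 with hs
  -- The comparison matrix has eigenvalue `κ` on `a` and `μ` on its orthogonal complement; `hμ` says
  -- that it has the same trace as `h`.
  have h1 : 0 ≤ ∑ α, ∑ β, (h α β - (κ - μ) / s * (a α * a β) - if α = β then μ else 0) ^ 2 :=
    Finset.sum_nonneg fun α _ => Finset.sum_nonneg fun β _ => sq_nonneg _
  have h2 : ∀ α, ∑ β, (h α β - (κ - μ) / s * (a α * a β) - if α = β then μ else 0) ^ 2 =
      ∑ β, h α β ^ 2 + ((κ - μ) / s) ^ 2 * a α ^ 2 * s + μ ^ 2 -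
        2 * ((κ - μ) / s) * κ * a α ^ 2 - 2 * μ * h α α + 2 * μ * ((κ - μ) / s) * a α ^ 2 := by
    intro α
    have e : ∀ β, (h α β - (κ - μ) / s * (a α * a β) - if α = β then μ else 0) ^ 2 =
        h α β ^ 2 + ((κ - μ) / s) ^ 2 * a α ^ 2 * a β ^ 2 -
        2 * ((κ - μ) / s) * a α * (h α β * a β) +
        (if α = β then μ ^ 2 - 2 * μ * h α β + 2 * μ * ((κ - μ) / s) * (a α * a β) else 0) :=
      fun β => by split_ifs <;> ring
    simp only [e, Finset.sum_add_distrib, Finset.sum_sub_distrib, ← Finset.mul_sum, heig,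
      Finset.sum_ite_eq, Finset.mem_univ, if_true, ← hs]
    ring
  simp only [h2, Finset.sum_add_distrib, Finset.sum_sub_distrib, ← Finset.mul_sum,
    ← Finset.sum_mul, ← hs, Finset.sum_const, Finset.card_univ, Fintype.card_fin,
    nsmul_eq_mul] at h1
  have h3 : ∑ α, h α α = (m - 1) * μ + κ := by linarith
  rw [h3] at h1
  have e : ((κ - μ) / s) ^ 2 * s * s = (κ - μ) ^ 2 := by field_simp
  have e2 : 2 * ((κ - μ) / s) * κ * s = 2 * κ * (κ - μ) := by field_simp
  have e3 : 2 * μ * ((κ - μ) / s) * s = 2 * μ * (κ - μ) := by field_simp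
  rw [e, e2, e3] at h1
  linarith

/-- The summand `(kρ)²` of `B` cancels `-k²ρ·ρ²`, and the other one leaves `k²ρ³ / (M - 1)` up to
`O(ρ²)`. As `ρ ≥ l`, every remaining term is at most a multiple of `ρ²`, and `ρ²` is divided out.
Here `M`, `A`, `B`, `E` stand for `m`, `mH`, `|A|²` and `m dH(ξ)`. -/
theorem bound_of_trace_inequality {M ρ ℓ l Λ k A B E : ℝ} (hM : 1 < M) (hρ : 0 < ρ)
    (hl : 0 < l) (hlℓ : l ≤ ℓ) (hℓρ : ℓ ≤ ρ) (hk : 0 < k) (hΛ : 0 ≤ Λ) (hA : |A| ≤ M * Λ)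
    (hE : |E| ≤ M * Λ * (ρ ^ 2 / ℓ))
    (hB : (k * ρ) ^ 2 + (A + k * ρ) ^ 2 / (M - 1) ≤ B)
    (h : -A - E + ρ * B - k ^ 2 * ρ * (ρ ^ 2 - ℓ ^ 2) - k * ρ * M + k * ρ ^ 2 * A ≤ 0) :
    k ^ 2 * ρ ≤ (M - 1) * (M * (Λ / l ^ 2 + Λ / l + Λ * k + k / l)) + 2 * (M * Λ) * k := by
  have hM1 : 0 < M - 1 := by linarith
  obtain ⟨hA1, hA2⟩ := abs_le.1 hA
  obtain ⟨hE1, hE2⟩ := abs_le.1 hE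
  have hlρ : l ≤ ρ := hlℓ.trans hℓρ
  have hMΛ : 0 ≤ M * Λ := by positivity
  have e1 : ρ ^ 2 / ℓ ≤ ρ ^ 2 / l := by gcongr
  have e2 : 1 ≤ ρ ^ 2 / l ^ 2 := by
    rw [le_div_iff₀ (by positivity), one_mul]; gcongr
  have e3 : ρ ≤ ρ ^ 2 / l := by
    rw [le_div_iff₀ hl, sq]; gcongr
  have h1 : ρ * ((k * ρ) ^ 2 + (A + k * ρ) ^ 2 / (M - 1)) ≤ ρ * B := by gcongr
  have h2 : ρ ^ 2 * (k ^ 2 * ρ) / (M - 1) - 2 * (M * Λ) * k * ρ ^ 2 / (M - 1) ≤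
      ρ * ((A + k * ρ) ^ 2 / (M - 1)) := by
    rw [← sub_div, ← mul_div_assoc]
    gcongr
    nlinarith [mul_nonneg (mul_nonneg hk.le (sq_nonneg ρ)) (sub_nonneg.2 hA1),
      mul_nonneg hρ.le (sq_nonneg A)]
  have h3 : k * ρ ^ 2 * A ≥ -(k * ρ ^ 2 * (M * Λ)) := by
    nlinarith [mul_nonneg hk.le (sq_nonneg ρ)]
  have h4 : 0 ≤ k ^ 2 * ρ * ℓ ^ 2 := by positivity
  have h5 : M * Λ * (ρ ^ 2 / ℓ) ≤ M * Λ * (ρ ^ 2 / l) := by gcongr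
  have h6 : M * Λ ≤ M * Λ * (ρ ^ 2 / l ^ 2) := le_mul_of_one_le_right hMΛ e2
  have h7 : k * M * ρ ≤ k * M * (ρ ^ 2 / l) := by gcongr
  have h8 : ρ ^ 2 * (k ^ 2 * ρ) / (M - 1) ≤ 2 * (M * Λ) * k * ρ ^ 2 / (M - 1) +
      (M * Λ * (ρ ^ 2 / l ^ 2) + M * Λ * (ρ ^ 2 / l) + k * ρ ^ 2 * (M * Λ) +
        k * M * (ρ ^ 2 / l)) := by nlinarith
  have h9 : ρ ^ 2 * (k ^ 2 * ρ) ≤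
      ρ ^ 2 * (2 * (M * Λ) * k + (M - 1) * (M * (Λ / l ^ 2 + Λ / l + Λ * k + k / l))) := by
    have h10 := mul_le_mul_of_nonneg_right h8 hM1.le
    rw [div_mul_cancel₀ _ hM1.ne', add_mul, div_mul_cancel₀ _ hM1.ne'] at h10
    refine h10.trans (le_of_eq ?_)
    ring
  linarith [le_of_mul_le_mul_left h9 (by positivity)]

/-! ### The estimate at an interior maximum. -/

namespace IsNormalField

variable {X n : Coord m → Mink m} {o : Mink m} {x : Coord m} {k : ℝ}

/-- Pythagoras with a timelike normal: for the position vector it reads `|Yᵀ|² = ρ² - ℓ²`. -/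
theorem sum_sq_mink (H : IsNormalField D X n) (hx : x ∈ D) {F : Matrix (Fin m) (Fin m) ℝ}
    (hF : ∀ i j, mink (fderivWithin ℝ X D x (colVec F i)) (fderivWithin ℝ X D x (colVec F j)) =
      if i = j then 1 else 0) (Y : Mink m) :
    ∑ α, mink Y (fderivWithin ℝ X D x (colVec F α)) ^ 2 = mink Y Y + mink Y (n x) ^ 2 := by
  have h : mink Y Y = mink Y (∑ i, mink Y (fderivWithin ℝ X D x (colVec F i)) •
      fderivWithin ℝ X D x (colVec F i) - mink Y (n x) • n x) := by
    conv_lhs => arg 2; rw [eq_sum_of_orthonormal hF (H.mink_self x hx)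
      (fun i => H.orthogonal x hx _) Y]
  rw [mink_sub_right, mink_sum_right, mink_smul_right] at h
  simp only [mink_smul_right] at h
  rw [h]
  simp only [sq]
  ring

/-- The tangential part of the position vector. -/
theorem exists_tangential (H : IsNormalField D X n) (hx : x ∈ D) {F : Matrix (Fin m) (Fin m) ℝ}
    (hF : ∀ i j, mink (fderivWithin ℝ X D x (colVec F i)) (fderivWithin ℝ X D x (colVec F j)) =
      if i = j then 1 else 0) (o : Mink m) :
    X x - o = fderivWithin ℝ X D x
      (∑ α, mink (X x - o) (fderivWithin ℝ X D x (colVec F α)) • colVec F α) +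
      supportFn o X n x • n x := by
  conv_lhs => rw [eq_sum_of_orthonormal hF (H.mink_self x hx) (fun i => H.orthogonal x hx _)
    (X x - o)]
  simp only [map_sum, map_smul, supportFn, neg_smul, sub_eq_add_neg]

/-- The interior estimate for the support function. -/
theorem supportFn_le_of_isLocalMax (H : IsNormalField D X n) (hm : 2 ≤ m)
    (hpos : ∀ y ∈ D, 0 < supportFn o X n y) (hx : x ∈ interior D)
    (hmax : IsLocalMax (testFn o X n k) x) (hk : 0 < k) {l ℓ Λ : ℝ} (hl : 0 < l) (hlℓ : l ≤ ℓ)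
    (hY : mink (X x - o) (X x - o) = -ℓ ^ 2) (hH : |meanCurvature D X x| ≤ Λ)
    (hgrad : gradNorm D X (meanCurvature D X) x ≤ Λ * (supportFn o X n x / ℓ)) :
    supportFn o X n x ≤ ℓ ∨ k ^ 2 * supportFn o X n x ≤
      (m - 1) * (m * (Λ / l ^ 2 + Λ / l + Λ * k + k / l)) + 2 * (m * Λ) * k := by
  -- Outside this case `|Yᵀ|² = ρ² - ℓ² > 0`, so `Yᵀ` is a genuine eigenvector.
  by_cases hρℓ : supportFn o X n x ≤ ℓ
  · exact Or.inl hρℓ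
  right
  have hxD := interior_subset hx
  have hm1 : (1 : ℝ) < m := by exact_mod_cast hm
  have hm0 : (m : ℝ) ≠ 0 := by positivity
  have hΛ : 0 ≤ Λ := (abs_nonneg _).trans hH
  obtain ⟨F, hFi, hF⟩ := H.exists_frame hxD
  have hρ := hpos x hxD
  set ρ := supportFn o X n x with hρdef
  have hℓ0 : 0 < ℓ := hl.trans_le hlℓ
  have hsum := H.sum_sq_mink hxD hF (X x - o)
  have hρ' : mink (X x - o) (n x) ^ 2 = ρ ^ 2 := by rw [hρdef, supportFn]; ring
  rw [hY, hρ'] at hsum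
  have hξ := H.exists_tangential hxD hF o
  set ξ := ∑ α, mink (X x - o) (fderivWithin ℝ X D x (colVec F α)) • colVec F α with hξdef
  have hn : D ∈ 𝓝 x := mem_interior_iff_mem_nhds.1 hx
  have hcrit0 : fderivWithin ℝ (testFn o X n k) D x = 0 := by
    rw [fderivWithin_of_mem_nhds hn]
    exact hmax.fderiv_eq_zero
  have hcrit : ∀ ζ, mink (X x - o) (fderivWithin ℝ n D x ζ) =
      -(k * ρ) * mink (X x - o) (fderivWithin ℝ X D x ζ) := fun ζ => by
    have h := H.fderivWithin_testFn (k := k) hpos hxD ζ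
    rw [hcrit0, ← hρdef] at h
    simp only [zero_apply] at h
    field_simp at h
    linarith
  have htrace := H.trace_inequality hxD hm0 hpos hFi hF hξ hcrit
    fun ζ => hessWithin_nonpos_of_isLocalMax H.uniqueDiffOn (H.contDiffOn_testFn hpos) hx hmax ζ
  rw [hsum, ← hρdef] at htrace
  have hcoef : ∀ α, ∑ β, mink (fderivWithin ℝ n D x (colVec F α))
      (fderivWithin ℝ X D x (colVec F β)) * mink (X x - o) (fderivWithin ℝ X D x (colVec F β)) =
      -(k * ρ) * mink (X x - o) (fderivWithin ℝ X D x (colVec F α)) := fun α => by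
    rw [← hcrit]
    conv_rhs => rw [eq_sum_of_orthonormal hF (H.mink_self x hxD)
      (fun i => H.orthogonal x hxD _) (fderivWithin ℝ n D x (colVec F α)),
      mink_comm _ (n x), H.mink_deriv_normal hxD, zero_smul, sub_zero, mink_sum_right]
    simp only [mink_smul_right]
  have hHsum := H.meanCurvature_eq_sum hxD hm0 hFi
  -- This `μ` is the average of the other eigenvalues: their sum is `mH - (-kρ)`.
  have hA2 := sum_sq_ge_of_eigenvector (m := m) (μ := (m * meanCurvature D X x + k * ρ) / (m - 1))
    (by rw [hsum]; nlinarith) hcoef (by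
      rw [mul_div_cancel₀ _ (by linarith), hHsum]; ring)
  -- Cauchy–Schwarz with `|ξ|² = ρ² - ℓ² ≤ ρ²` and `|∇H| ≤ Λρ/ℓ`: only quadratic growth in `ρ`.
  have hdH : |fderivWithin ℝ (meanCurvature D X) D x ξ| ≤ Λ * (ρ ^ 2 / ℓ) := by
    have h1 : fderivWithin ℝ (meanCurvature D X) D x ξ =
        ∑ α, mink (X x - o) (fderivWithin ℝ X D x (colVec F α)) *
          fderivWithin ℝ (meanCurvature D X) D x (colVec F α) := by
      simp [hξdef, map_sum]
    have h2 := Finset.sum_mul_sq_le_sq_mul_sq Finset.univ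
      (fun α => mink (X x - o) (fderivWithin ℝ X D x (colVec F α)))
      (fun α => fderivWithin ℝ (meanCurvature D X) D x (colVec F α))
    rw [← h1, hsum] at h2
    rw [gradNorm_eq hFi] at hgrad
    have h3 := Real.sqrt_le_iff.1 hgrad
    refine abs_le_of_sq_le_sq ?_ (by positivity)
    calc _ ≤ _ := h2
      _ ≤ ρ ^ 2 * (Λ * (ρ / ℓ)) ^ 2 :=
        mul_le_mul (by nlinarith) h3.2 (Finset.sum_nonneg fun _ _ => sq_nonneg _) (sq_nonneg _)
      _ = _ := by ring
  refine bound_of_trace_inequality (A := m * meanCurvature D X x)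
    (E := m * fderivWithin ℝ (meanCurvature D X) D x ξ) hm1 hρ hl hlℓ (not_le.1 hρℓ).le hk hΛ ?_ ?_
    ?_ (by rwa [show -ℓ ^ 2 + ρ ^ 2 = ρ ^ 2 - ℓ ^ 2 by ring] at htrace)
  · rw [abs_mul, Nat.abs_cast]
    gcongr
  · rw [abs_mul, Nat.abs_cast, mul_assoc]
    gcongr
  · refine le_of_eq_of_le ?_ hA2
    have : (m : ℝ) - 1 ≠ 0 := by linarith
    field_simp

end IsNormalField

end Within

section Ball

variable {m : ℕ}

/-! ### Geodesic balls in the hyperboloid -/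

theorem hyperboloid_fst_pos (p : hyperboloid m) : 0 < p.1.1 := by
  have h := p.2.2
  simp [mink] at h
  exact h

theorem hyperboloid_fst_sq (p : hyperboloid m) : p.1.1 ^ 2 = 1 + ‖p.1.2‖ ^ 2 := by
  have h := p.2.1
  rw [mink_eq_inner, real_inner_self_eq_norm_sq] at h
  linarith

theorem hyperboloid_fst_eq (p : hyperboloid m) : p.1.1 = Real.sqrt (1 + ‖p.1.2‖ ^ 2) := by
  rw [← hyperboloid_fst_sq, Real.sqrt_sq (hyperboloid_fst_pos p).le]

theorem hypPoint_snd (p : hyperboloid m) : hypPoint p.1.2 = p :=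
  Subtype.ext (Prod.ext (hyperboloid_fst_eq p).symm rfl)

/-- The hyperbolic cosine `-⟨p, x⟩` of the distance to `p`. -/
noncomputable def coshDist (p : hyperboloid m) (x : Coord m) : ℝ :=
  p.1.1 * Real.sqrt (1 + ‖x‖ ^ 2) - inner ℝ p.1.2 x

theorem coshDist_eq (p : hyperboloid m) (x : Coord m) :
    coshDist p x = -mink p.1 (hypPoint x).1 := by
  rw [mink_eq_inner, coshDist, hypPoint]
  ring

/-- The reversed Cauchy–Schwarz inequality `-⟨p, q⟩ ≥ 1` on the hyperboloid; after squaring it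
follows from `(‖x‖ - ‖y‖)² ≥ 0`. -/
theorem one_add_inner_le (x y : Coord m) :
    1 + inner ℝ x y ≤ Real.sqrt (1 + ‖x‖ ^ 2) * Real.sqrt (1 + ‖y‖ ^ 2) := by
  have h := real_inner_le_norm x y
  rw [← Real.sqrt_mul (by positivity)]
  refine (add_le_add_right h 1).trans (Real.le_sqrt_of_sq_le ?_)
  nlinarith [sq_nonneg (‖x‖ - ‖y‖)]

theorem one_le_coshDist (p : hyperboloid m) (x : Coord m) : 1 ≤ coshDist p x := by
  rw [coshDist, hyperboloid_fst_eq]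
  linarith [one_add_inner_le p.1.2 x]

theorem coshDist_eq_cosh (p : hyperboloid m) (x : Coord m) :
    coshDist p x = Real.cosh (hypDist p (hypPoint x)) := by
  rw [hypDist, ← coshDist_eq, Real.cosh_arcosh (one_le_coshDist p x)]

theorem hypDist_nonneg (p : hyperboloid m) (x : Coord m) : 0 ≤ hypDist p (hypPoint x) := by
  rw [hypDist, ← coshDist_eq]
  exact Real.arcosh_nonneg (one_le_coshDist p x)

theorem hypDist_le_iff {p : hyperboloid m} {x : Coord m} {r : ℝ} (hr : 0 < r) :
    hypDist p (hypPoint x) ≤ r ↔ coshDist p x ≤ Real.cosh r := by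
  rw [coshDist_eq_cosh, Real.cosh_le_cosh, abs_of_nonneg (hypDist_nonneg p x), abs_of_pos hr]

theorem hypDist_lt_iff {p : hyperboloid m} {x : Coord m} {r : ℝ} (hr : 0 < r) :
    hypDist p (hypPoint x) < r ↔ coshDist p x < Real.cosh r := by
  rw [coshDist_eq_cosh, Real.cosh_lt_cosh, abs_of_nonneg (hypDist_nonneg p x), abs_of_pos hr]

theorem hypDist_eq_iff {p : hyperboloid m} {x : Coord m} {r : ℝ} (hr : 0 < r) :
    hypDist p (hypPoint x) = r ↔ coshDist p x = Real.cosh r := by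
  rw [le_antisymm_iff, le_antisymm_iff, hypDist_le_iff hr,
    ← not_lt (a := hypDist p (hypPoint x)), hypDist_lt_iff hr, not_lt]

theorem mem_closedBallCoord {p : hyperboloid m} {x : Coord m} {r : ℝ} (hr : 0 < r) :
    x ∈ closedBallCoord p r ↔ coshDist p x ≤ Real.cosh r :=
  hypDist_le_iff hr

theorem continuous_coshDist (p : hyperboloid m) : Continuous (coshDist p) := by
  unfold coshDist
  fun_prop

theorem sqrt_one_add_norm_sq_convex (x y : Coord m) {a b : ℝ} (ha : 0 ≤ a) (hb : 0 ≤ b)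
    (hab : a + b = 1) : Real.sqrt (1 + ‖a • x + b • y‖ ^ 2) ≤
      a * Real.sqrt (1 + ‖x‖ ^ 2) + b * Real.sqrt (1 + ‖y‖ ^ 2) := by
  refine Real.sqrt_le_iff.2 ⟨by positivity, ?_⟩
  have h1 : ‖a • x + b • y‖ ^ 2 = a ^ 2 * ‖x‖ ^ 2 + 2 * (a * b) * inner ℝ x y + b ^ 2 * ‖y‖ ^ 2 := by
    rw [norm_add_sq_real, norm_smul, norm_smul, inner_smul_left, inner_smul_right,
      Real.norm_of_nonneg ha, Real.norm_of_nonneg hb]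
    simp only [conj_trivial]
    ring
  have h2 := mul_le_mul_of_nonneg_left (one_add_inner_le x y) (mul_nonneg ha hb)
  have h3 := Real.sq_sqrt (show 0 ≤ 1 + ‖x‖ ^ 2 by positivity)
  have h4 := Real.sq_sqrt (show 0 ≤ 1 + ‖y‖ ^ 2 by positivity)
  have h5 : (1 : ℝ) = a ^ 2 + 2 * (a * b) + b ^ 2 := by
    have := congrArg (· ^ 2) hab
    simp only [one_pow] at this
    linarith
  rw [h1, add_sq, mul_pow, mul_pow, h3, h4]
  nlinarith

/-- A positive multiple of the convex function `√(1 + |x|²)` plus a linear function. Geodesic balls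
are its sublevel sets, hence convex in these coordinates. -/
theorem convexOn_coshDist (p : hyperboloid m) : ConvexOn ℝ univ (coshDist p) := by
  refine ⟨convex_univ, fun x _ y _ a b ha hb hab => ?_⟩
  have h1 := mul_le_mul_of_nonneg_left (sqrt_one_add_norm_sq_convex x y ha hb hab)
    (hyperboloid_fst_pos p).le
  simp only [coshDist, smul_eq_mul]
  rw [inner_add_right, inner_smul_right, inner_smul_right]
  linarith

theorem closedBallCoord_eq (p : hyperboloid m) {r : ℝ} (hr : 0 < r) :
    closedBallCoord p r = {x | coshDist p x ≤ Real.cosh r} :=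
  Set.ext fun _ => mem_closedBallCoord hr

theorem convex_closedBallCoord (p : hyperboloid m) {r : ℝ} (hr : 0 < r) :
    Convex ℝ (closedBallCoord p r) := by
  have h := (convexOn_coshDist p).convex_le (Real.cosh r)
  rw [closedBallCoord_eq p hr]
  simpa using h

theorem setOf_coshDist_lt_subset_interior (p : hyperboloid m) {r : ℝ} (hr : 0 < r) :
    {x | coshDist p x < Real.cosh r} ⊆ interior (closedBallCoord p r) :=
  interior_maximal (fun _ hx => (mem_closedBallCoord hr).2 (le_of_lt hx))
    (isOpen_lt (continuous_coshDist p) continuous_const)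

theorem coshDist_self (p : hyperboloid m) : coshDist p p.1.2 = 1 := by
  rw [coshDist_eq, hypPoint_snd, p.2.1, neg_neg]

theorem interior_closedBallCoord_nonempty (p : hyperboloid m) {r : ℝ} (hr : 0 < r) :
    (interior (closedBallCoord p r)).Nonempty := by
  refine ⟨p.1.2, setOf_coshDist_lt_subset_interior p hr ?_⟩
  show coshDist p p.1.2 < _
  rw [coshDist_self]
  exact Real.one_lt_cosh.2 hr.ne'

/-- On the segment towards the centre, where `coshDist` equals `1 < cosh r`, convexity makes the
inequality strict. -/
theorem mem_closure_setOf_coshDist_lt {p : hyperboloid m} {r : ℝ} (hr : 0 < r) {x : Coord m}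
    (hx : coshDist p x ≤ Real.cosh r) : x ∈ closure {y | coshDist p y < Real.cosh r} := by
  have hlim : Tendsto (fun t : ℝ => (1 - t) • x + t • p.1.2) (𝓝[>] 0) (𝓝 x) := by
    have hc : Continuous fun t : ℝ => (1 - t) • x + t • p.1.2 := by fun_prop
    have h := hc.tendsto 0
    simp only [sub_zero, one_smul, zero_smul, add_zero] at h
    exact h.mono_left nhdsWithin_le_nhds
  refine mem_closure_of_tendsto hlim ?_
  filter_upwards [Ioo_mem_nhdsGT (zero_lt_one' ℝ)] with t ht
  have h1 := (convexOn_coshDist p).2 (mem_univ x) (mem_univ p.1.2) (sub_nonneg.2 ht.2.le) ht.1.le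
    (sub_add_cancel 1 t)
  rw [coshDist_self, smul_eq_mul, smul_eq_mul] at h1
  have h2 := Real.one_lt_cosh.2 hr.ne'
  show _ < _
  nlinarith [mul_le_mul_of_nonneg_left hx (sub_nonneg.2 ht.2.le), mul_pos ht.1 (sub_pos.2 h2)]

theorem isCompact_closedBallCoord (p : hyperboloid m) {r : ℝ} (hr : 0 < r) :
    IsCompact (closedBallCoord p r) := by
  refine Metric.isCompact_of_isClosed_isBounded ?_ ?_
  · rw [closedBallCoord_eq p hr]
    exact isClosed_le (continuous_coshDist p) continuous_const
  -- As `p` is timelike, `-⟨p, x⟩ ≥ (p⁰ - |p'|) |x|` with a positive factor, which bounds the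
  -- sublevel set.
  · have hP := hyperboloid_fst_pos p
    have hlt : ‖p.1.2‖ < p.1.1 :=
      lt_of_pow_lt_pow_left₀ 2 hP.le (by rw [hyperboloid_fst_sq p]; linarith)
    refine (Metric.isBounded_closedBall (x := (0 : Coord m))
      (r := Real.cosh r / (p.1.1 - ‖p.1.2‖))).subset fun x hx => ?_
    rw [mem_closedBallCoord hr, coshDist] at hx
    rw [mem_closedBall_zero_iff, le_div_iff₀ (sub_pos.2 hlt)]
    have h1 := real_inner_le_norm p.1.2 x
    have h2 : ‖x‖ ≤ Real.sqrt (1 + ‖x‖ ^ 2) := Real.le_sqrt_of_sq_le (by linarith)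
    have h3 := mul_le_mul_of_nonneg_left h2 hP.le
    linarith

/-- The point of the ball seen from a boundary point in the direction of the inner normal. -/
theorem inv_cosh_smul_mem_closedBallCoord (p : hyperboloid m) {r : ℝ} (hr : 0 < r) :
    (Real.cosh r)⁻¹ • p.1.2 ∈ closedBallCoord p r := by
  rw [mem_closedBallCoord hr, coshDist]
  have hC := Real.one_le_cosh r
  set C := Real.cosh r
  have hC0 : 0 < C := by linarith
  have hP := hyperboloid_fst_pos p
  have hP2 := hyperboloid_fst_sq p
  rw [inner_smul_right, real_inner_self_eq_norm_sq, norm_smul, Real.norm_of_nonneg (by positivity)]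
  have h1 : p.1.1 * Real.sqrt (1 + (C⁻¹ * ‖p.1.2‖) ^ 2) ≤ C + C⁻¹ * ‖p.1.2‖ ^ 2 := by
    rw [← Real.sqrt_sq hP.le, ← Real.sqrt_mul (by positivity)]
    refine Real.sqrt_le_iff.2 ⟨by positivity, ?_⟩
    rw [hP2]
    have h2 : (C + C⁻¹ * ‖p.1.2‖ ^ 2) ^ 2 - (1 + ‖p.1.2‖ ^ 2) * (1 + (C⁻¹ * ‖p.1.2‖) ^ 2) =
        (C ^ 2 - 1) * (1 + C⁻¹ ^ 2 * ‖p.1.2‖ ^ 2) := by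
      field_simp
      ring
    have h3 : 0 ≤ (C ^ 2 - 1) * (1 + C⁻¹ ^ 2 * ‖p.1.2‖ ^ 2) :=
      mul_nonneg (by nlinarith) (by positivity)
    linarith
  linarith

/-! ### The hyperboloid embedding -/

theorem mink_hypPoint_self (x : Coord m) : mink (hypPoint x).1 (hypPoint x).1 = -1 :=
  (hypPoint x).2.1

theorem contDiff_hypPoint {k : WithTop ℕ∞} :
    ContDiff ℝ k fun x : Coord m => ((hypPoint x).1 : Mink m) := by
  have h1 : ContDiff ℝ k fun x : Coord m => (1 + ‖x‖ ^ 2 : ℝ) :=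
    contDiff_const.add (contDiff_norm_sq ℝ)
  exact (h1.sqrt fun x => by positivity).prodMk contDiff_id

theorem hasFDerivAt_hypPoint (x : Coord m) :
    HasFDerivAt (fun x : Coord m => ((hypPoint x).1 : Mink m))
      (((Real.sqrt (1 + ‖x‖ ^ 2))⁻¹ • innerSL ℝ x).prod (ContinuousLinearMap.id ℝ (Coord m))) x := by
  have h0 : (1 + ‖x‖ ^ 2 : ℝ) ≠ 0 := by positivity
  have h1 := (((hasStrictFDerivAt_norm_sq x).hasFDerivAt.const_add 1).sqrt h0).prodMk
    (hasFDerivAt_id x)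
  refine h1.congr_fderiv ?_
  congr 1
  rw [two_smul, ← two_smul ℝ, smul_smul]
  congr 1
  field_simp

end Ball

/-! ### The differential of the hyperboloid embedding and its tangent vectors. -/

section Within

variable {m : ℕ} {D : Set (Coord m)}

theorem fderivWithin_hypPoint {x : Coord m} (hD : UniqueDiffWithinAt ℝ D x) (ζ : Coord m) :
    fderivWithin ℝ (fun x : Coord m => ((hypPoint x).1 : Mink m)) D x ζ =
      ((Real.sqrt (1 + ‖x‖ ^ 2))⁻¹ * inner ℝ x ζ, ζ) := by
  rw [(hasFDerivAt_hypPoint x).hasFDerivWithinAt.fderivWithin hD]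
  simp

/-- The differential of the embedding of the hyperboloid. -/
noncomputable def hypDeriv (x ζ : Coord m) : Mink m :=
  ((Real.sqrt (1 + ‖x‖ ^ 2))⁻¹ * inner ℝ x ζ, ζ)

theorem mink_hypPoint_hypDeriv (x ζ : Coord m) : mink (hypPoint x).1 (hypDeriv x ζ) = 0 := by
  have h : Real.sqrt (1 + ‖x‖ ^ 2) ≠ 0 := by positivity
  rw [mink_eq_inner, hypDeriv, hypPoint]
  field_simp
  ring

theorem hypDeriv_snd_of_mink_eq_zero {x : Coord m} {b : Mink m}
    (hb : mink (hypPoint x).1 b = 0) : hypDeriv x b.2 = b := by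
  have h : Real.sqrt (1 + ‖x‖ ^ 2) ≠ 0 := by positivity
  rw [mink_eq_inner, hypPoint] at hb
  refine Prod.ext ?_ rfl
  rw [hypDeriv]
  field_simp
  linarith

theorem hypDeriv_smul (x ζ : Coord m) (a : ℝ) : hypDeriv x (a • ζ) = a • hypDeriv x ζ := by
  rw [hypDeriv, hypDeriv, inner_smul_right, Prod.smul_mk, smul_eq_mul]
  ring_nf

/-! ### The gradient of a function on the hyperboloid -/

/-- The Euclidean gradient within `D`. -/
noncomputable def euclGrad (D : Set (Coord m)) (v : Coord m → ℝ) (x : Coord m) : Coord m :=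
  (InnerProductSpace.toDual ℝ (Coord m)).symm (fderivWithin ℝ v D x)

theorem inner_euclGrad (v : Coord m → ℝ) (x ζ : Coord m) :
    inner ℝ (euclGrad D v x) ζ = fderivWithin ℝ v D x ζ := by
  simp [euclGrad]

/-- The hyperbolic gradient within `D`, as a vector of Minkowski space. -/
noncomputable def hypGrad (D : Set (Coord m)) (v : Coord m → ℝ) (x : Coord m) : Mink m :=
  (0, euclGrad D v x) + fderivWithin ℝ v D x x • (hypPoint x).1

theorem mink_hypPoint_hypGrad (v : Coord m → ℝ) (x : Coord m) :
    mink (hypPoint x).1 (hypGrad D v x) = 0 := by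
  rw [hypGrad, mink_add_right, mink_smul_right, mink_hypPoint_self, mink_eq_inner, hypPoint]
  simp only
  rw [real_inner_comm, inner_euclGrad]
  ring

theorem mink_hypGrad_hypDeriv (v : Coord m → ℝ) (x ζ : Coord m) :
    mink (hypGrad D v x) (hypDeriv x ζ) = fderivWithin ℝ v D x ζ := by
  rw [hypGrad, mink_add_left, mink_smul_left, mink_hypPoint_hypDeriv, mink_eq_inner, hypDeriv]
  simp only
  rw [inner_euclGrad]
  ring

theorem hypDeriv_hypGrad_snd (v : Coord m → ℝ) (x : Coord m) :
    hypDeriv x (hypGrad D v x).2 = hypGrad D v x :=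
  hypDeriv_snd_of_mink_eq_zero (mink_hypPoint_hypGrad v x)

theorem fderivWithin_hypGrad_snd (v : Coord m → ℝ) (x : Coord m) :
    fderivWithin ℝ v D x (hypGrad D v x).2 = mink (hypGrad D v x) (hypGrad D v x) := by
  rw [← mink_hypGrad_hypDeriv, hypDeriv_hypGrad_snd]

theorem mink_hypGrad_self (v : Coord m → ℝ) (x : Coord m) :
    mink (hypGrad D v x) (hypGrad D v x) =
      ‖euclGrad D v x‖ ^ 2 + fderivWithin ℝ v D x x ^ 2 := by
  rw [← fderivWithin_hypGrad_snd, ← inner_euclGrad, hypGrad]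
  simp only [Prod.snd_add, Prod.smul_snd, hypPoint, inner_add_right, inner_smul_right,
    inner_euclGrad, real_inner_self_eq_norm_sq]
  rw [← real_inner_self_eq_norm_sq, inner_euclGrad]
  ring

theorem mink_hypGrad_self_nonneg (v : Coord m → ℝ) (x : Coord m) :
    0 ≤ mink (hypGrad D v x) (hypGrad D v x) := by
  rw [mink_hypGrad_self]
  positivity

/-- In these coordinates `h = I - x xᵀ / (1 + |x|²)`, a rank-one perturbation with inverse `I + x
xᵀ`. -/
theorem hypGradNorm_eq {u : hyperboloid m → ℝ} {x : Coord m} (hD : UniqueDiffWithinAt ℝ D x) :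
    hypGradNorm D u x = Real.sqrt (mink (hypGrad D (fun y => u (hypPoint y)) x)
      (hypGrad D (fun y => u (hypPoint y)) x)) := by
  set v : Coord m → ℝ := fun y => u (hypPoint y)
  have hs := Real.sq_sqrt (show 0 ≤ 1 + ‖x‖ ^ 2 by positivity)
  have hx : ∑ i, x i * x i = ‖x‖ ^ 2 := by
    rw [EuclideanSpace.real_norm_sq_eq]
    exact Finset.sum_congr rfl fun i _ => (pow_two (x i)).symm
  have hg : inducedMetric D (fun y => ((hypPoint y).1 : Mink m)) x =
      Matrix.of fun i j => (if i = j then 1 else 0) - (1 + ‖x‖ ^ 2)⁻¹ * (x i * x j) := by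
    ext i j
    rw [inducedMetric, Matrix.of_apply, Matrix.of_apply, partialWithin, partialWithin,
      fderivWithin_hypPoint hD, fderivWithin_hypPoint hD, mink_eq_inner]
    simp only [EuclideanSpace.inner_single_right, PiLp.single_apply,
      conj_trivial, one_mul]
    rw [show ((Real.sqrt (1 + ‖x‖ ^ 2))⁻¹ * x i * ((Real.sqrt (1 + ‖x‖ ^ 2))⁻¹ * x j)) =
      ((Real.sqrt (1 + ‖x‖ ^ 2)) ^ 2)⁻¹ * (x i * x j) by ring, hs]
    simp only [eq_comm (a := j)]
    ring
  have hinv : (inducedMetric D (fun y => ((hypPoint y).1 : Mink m)) x)⁻¹ =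
      Matrix.of fun i j => (if i = j then 1 else 0) + x i * x j := by
    refine Matrix.inv_eq_right_inv ?_
    rw [hg]
    ext i j
    have h0 : (1 + ‖x‖ ^ 2 : ℝ) ≠ 0 := by positivity
    have e : ∀ k, ((if i = k then 1 else 0) - (1 + ‖x‖ ^ 2)⁻¹ * (x i * x k)) *
        ((if k = j then (1 : ℝ) else 0) + x k * x j) =
        (if i = k then (if k = j then (1 : ℝ) else 0) + x k * x j else 0) -
        (if k = j then (1 + ‖x‖ ^ 2)⁻¹ * (x i * x k) else 0) -
        (1 + ‖x‖ ^ 2)⁻¹ * (x i * x j) * (x k * x k) := fun k => by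
      split_ifs <;> ring
    rw [Matrix.mul_apply]
    simp only [Matrix.of_apply, e, Finset.sum_sub_distrib, ← Finset.mul_sum, hx,
      Finset.sum_ite_eq, Finset.sum_ite_eq', Finset.mem_univ, if_true, Matrix.one_apply]
    field_simp
    ring
  have hp : ∀ i, partialWithin D v i x = euclGrad D v x i := fun i => by
    rw [partialWithin, ← inner_euclGrad, EuclideanSpace.inner_single_right]
    simp
  have hxv : ∑ i, x i * euclGrad D v x i = fderivWithin ℝ v D x x := by
    rw [← inner_euclGrad, PiLp.inner_apply]
    simp
  rw [hypGradNorm, gradNorm, hinv, mink_hypGrad_self, EuclideanSpace.real_norm_sq_eq, ← hxv]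
  congr 1
  have e : ∀ i j, (Matrix.of fun i j => (if i = j then (1 : ℝ) else 0) + x i * x j) i j *
      partialWithin D v i x * partialWithin D v j x =
      (if i = j then euclGrad D v x i * euclGrad D v x j else 0) +
      (x i * euclGrad D v x i) * (x j * euclGrad D v x j) := fun i j => by
    rw [hp, hp, Matrix.of_apply]
    split_ifs <;> ring
  have hv : (fun y => u (hypPoint y)) = v := rfl
  simp only [hv, e, Finset.sum_add_distrib, ← Finset.mul_sum, ← Finset.sum_mul, Finset.sum_ite_eq,
    Finset.mem_univ, if_true]
  simp only [sq]

/-! ### Radial graphs -/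

theorem fderivWithin_radialGraph {o : Mink m} {u : hyperboloid m → ℝ} {x : Coord m}
    (hD : UniqueDiffWithinAt ℝ D x) (hu : DifferentiableWithinAt ℝ (fun y => u (hypPoint y)) D x)
    (ζ : Coord m) :
    fderivWithin ℝ (radialGraph o u) D x ζ = Real.exp (u (hypPoint x)) •
      (fderivWithin ℝ (fun y => u (hypPoint y)) D x ζ • (hypPoint x).1 + hypDeriv x ζ) := by
  have h := ((hu.hasFDerivWithinAt.exp).smul (hasFDerivAt_hypPoint x).hasFDerivWithinAt).const_add o
  have h' : HasFDerivWithinAt (radialGraph o u) _ D x := h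
  rw [h'.fderivWithin hD]
  simp [hypDeriv, smul_smul, add_comm]

theorem contDiffOn_radialGraph {k : WithTop ℕ∞} {o : Mink m} {u : hyperboloid m → ℝ}
    (hu : ContDiffOn ℝ k (fun y => u (hypPoint y)) D) : ContDiffOn ℝ k (radialGraph o u) D :=
  contDiffOn_const.add (hu.exp.smul contDiff_hypPoint.contDiffOn)

theorem IsSpacelike.mink_pos {X : Coord m → Mink m} (h : IsSpacelike D X) {x : Coord m}
    (hx : x ∈ D) {ζ : Coord m} (hζ : ζ ≠ 0) :
    0 < mink (fderivWithin ℝ X D x ζ) (fderivWithin ℝ X D x ζ) := by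
  have h1 := (h x hx).dotProduct_mulVec_pos (x := fun i => ζ i)
    (fun h0 => hζ (by ext i; exact congrFun h0 i))
  have h2 : ζ = ∑ i, ζ i • EuclideanSpace.single i (1 : ℝ) := by
    ext j
    simp [Finset.sum_apply, Pi.single_apply]
  conv_rhs => rw [h2]
  simp only [map_sum, map_smul, mink_sum_left, mink_sum_right, mink_smul_left, mink_smul_right]
  refine lt_of_lt_of_eq h1 ?_
  simp only [dotProduct, Matrix.mulVec, Finset.mul_sum, inducedMetric, Matrix.of_apply,
    partialWithin]
  exact Finset.sum_congr rfl fun i _ => Finset.sum_congr rfl fun j _ => by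
    simp only [Pi.star_apply, star_trivial]
    rw [mink_comm]
    ring

/-- A spacelike radial graph has `|Du| < 1`. -/
theorem mink_hypGrad_self_lt_one {o : Mink m} {u : hyperboloid m → ℝ} {x : Coord m}
    (hD : UniqueDiffWithinAt ℝ D x) (hu : DifferentiableWithinAt ℝ (fun y => u (hypPoint y)) D x)
    (hx : x ∈ D) (h : IsSpacelike D (radialGraph o u)) :
    mink (hypGrad D (fun y => u (hypPoint y)) x) (hypGrad D (fun y => u (hypPoint y)) x) < 1 := by
  set v : Coord m → ℝ := fun y => u (hypPoint y)
  set ζ := (hypGrad D v x).2 with hζdef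
  by_cases hζ : ζ = 0
  · rw [← fderivWithin_hypGrad_snd, ← hζdef, hζ, map_zero]
    exact zero_lt_one
  -- In the gradient direction the induced metric is `e^{2u} (s - s²)` with `s = |Du|²`; positivity
  -- forces `s < 1`.
  · have h1 := h.mink_pos hx hζ
    rw [fderivWithin_radialGraph hD hu, mink_smul_left, mink_smul_right, hζdef,
      hypDeriv_hypGrad_snd, fderivWithin_hypGrad_snd] at h1
    simp only [mink_add_left, mink_add_right, mink_smul_left, mink_smul_right,
      mink_hypPoint_hypGrad, mink_comm (hypGrad D v x) (hypPoint x).1, mink_hypPoint_self] at h1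
    have he := Real.exp_pos (u (hypPoint x))
    have h2 := (mul_pos_iff_of_pos_left he).1 ((mul_pos_iff_of_pos_left he).1 h1)
    nlinarith [mink_hypGrad_self_nonneg (D := D) v x]

/-- The future unit normal `w (q + Du)` of the radial graph. -/
noncomputable def radialNormal (D : Set (Coord m)) (v : Coord m → ℝ) (x : Coord m) : Mink m :=
  (Real.sqrt (1 - mink (hypGrad D v x) (hypGrad D v x)))⁻¹ • ((hypPoint x).1 + hypGrad D v x)

theorem contDiffOn_hypGrad {v : Coord m → ℝ} (hD : UniqueDiffOn ℝ D) (hv : ContDiffOn ℝ 3 v D) :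
    ContDiffOn ℝ 2 (hypGrad D v) D := by
  have h1 : ContDiffOn ℝ 2 (fderivWithin ℝ v D) D := hv.fderivWithin hD (by norm_num)
  have h2 : ContDiffOn ℝ 2 (euclGrad D v) D :=
    ((InnerProductSpace.toDual ℝ (Coord m)).symm.toContinuousLinearEquiv.contDiff).comp_contDiffOn
      h1
  exact (contDiffOn_const.prodMk h2).add
    ((h1.clm_apply contDiffOn_id).smul contDiff_hypPoint.contDiffOn)

theorem mink_radialNormal_self {v : Coord m → ℝ} {x : Coord m}
    (h : mink (hypGrad D v x) (hypGrad D v x) < 1) :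
    mink (radialNormal D v x) (radialNormal D v x) = -1 := by
  have h0 : 0 < 1 - mink (hypGrad D v x) (hypGrad D v x) := by linarith
  rw [radialNormal, mink_smul_left, mink_smul_right, ← mul_assoc, ← mul_inv,
    Real.mul_self_sqrt h0.le]
  simp only [mink_add_left, mink_add_right, mink_hypPoint_hypGrad,
    mink_comm (hypGrad D v x) (hypPoint x).1, mink_hypPoint_self]
  field_simp
  ring

theorem radialNormal_future {v : Coord m → ℝ} {x : Coord m}
    (h : mink (hypGrad D v x) (hypGrad D v x) < 1) :
    mink (radialNormal D v x) (1, 0) < 0 := by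
  have h0 : 0 < 1 - mink (hypGrad D v x) (hypGrad D v x) := by linarith
  have h1 : 0 < (Real.sqrt (1 - mink (hypGrad D v x) (hypGrad D v x)))⁻¹ := by positivity
  rw [mink_hypGrad_self] at h
  -- The time component of `q + Du` is `√(1 + |x|²) (1 + dv(x))`, and `dv(x)² ≤ |Du|² < 1`.
  have h2 : -1 < fderivWithin ℝ v D x x := by nlinarith [sq_nonneg ‖euclGrad D v x‖]
  have h3 : 0 < Real.sqrt (1 + ‖x‖ ^ 2) := by positivity
  have h4 : mink ((hypPoint x).1 + hypGrad D v x) (1, 0) =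
      -(Real.sqrt (1 + ‖x‖ ^ 2) * (1 + fderivWithin ℝ v D x x)) := by
    rw [mink_eq_inner]
    simp only [hypGrad, hypPoint, Prod.fst_add, Prod.smul_fst, smul_eq_mul, inner_zero_right]
    ring
  rw [radialNormal, mink_smul_left, h4]
  refine mul_neg_of_pos_of_neg h1 ?_
  nlinarith

theorem mink_hypPoint_radialNormal (v : Coord m → ℝ) (x : Coord m) :
    mink (hypPoint x).1 (radialNormal D v x) =
      -(Real.sqrt (1 - mink (hypGrad D v x) (hypGrad D v x)))⁻¹ := by
  rw [radialNormal, mink_smul_right, mink_add_right, mink_hypPoint_self, mink_hypPoint_hypGrad]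
  ring

theorem isNormalField_radialNormal {o : Mink m} {u : hyperboloid m → ℝ} (hD : Convex ℝ D)
    (hD' : (interior D).Nonempty) (hu : ContDiffOn ℝ 3 (fun y => u (hypPoint y)) D)
    (h : IsSpacelike D (radialGraph o u)) :
    IsNormalField D (radialGraph o u) (radialNormal D fun y => u (hypPoint y)) := by
  set v : Coord m → ℝ := fun y => u (hypPoint y)
  have hU := uniqueDiffOn_convex hD hD'
  have hd : ∀ x ∈ D, DifferentiableWithinAt ℝ v D x := hu.differentiableOn (by norm_num)
  have hlt : ∀ x ∈ D, mink (hypGrad D v x) (hypGrad D v x) < 1 := fun x hx =>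
    mink_hypGrad_self_lt_one (hU x hx) (hd x hx) hx h
  refine ⟨hD, hD', contDiffOn_radialGraph hu, ?_, h, fun x hx => mink_radialNormal_self (hlt x hx),
    fun x hx => radialNormal_future (hlt x hx), fun x hx ζ => ?_⟩
  · have h1 := contDiffOn_hypGrad hU hu
    have h2 : ContDiffOn ℝ 2 (fun x => 1 - mink (hypGrad D v x) (hypGrad D v x)) D :=
      contDiffOn_const.sub (contDiffOn_mink h1 h1)
    exact ((h2.sqrt fun x hx => (by linarith [hlt x hx] : (0 : ℝ) < _).ne').inv fun x hx =>
      (Real.sqrt_pos.2 (by linarith [hlt x hx])).ne').smul (contDiff_hypPoint.contDiffOn.add h1)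
  · rw [fderivWithin_radialGraph (hU x hx) (hd x hx), radialNormal, mink_smul_left,
      mink_smul_right]
    simp only [mink_add_left, mink_add_right, mink_smul_right, mink_hypPoint_self,
      mink_hypPoint_hypDeriv, mink_comm (hypGrad D v x) (hypPoint x).1, mink_hypPoint_hypGrad,
      mink_hypGrad_hypDeriv]
    have : fderivWithin ℝ v D x ζ = fderivWithin ℝ (fun y => u (hypPoint y)) D x ζ := rfl
    rw [this]
    ring

theorem positionField_radialGraph (o : Mink m) (u : hyperboloid m → ℝ) (x : Coord m) :
    positionField o (radialGraph o u x) = (hypPoint x).1 := by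
  have he := Real.exp_pos (u (hypPoint x))
  have h1 : radialGraph o u x - o = Real.exp (u (hypPoint x)) • (hypPoint x).1 := by
    simp [radialGraph]
  rw [positionField, timeSep, h1, mink_smul_left, mink_smul_right, mink_hypPoint_self, mul_neg_one,
    mul_neg, abs_neg, abs_mul_self, Real.sqrt_mul_self he.le, smul_smul, inv_mul_cancel₀ he.ne',
    one_smul]

/-! ### Curves in geodesic spheres -/

/-- Second order chain rule along a curve in `D`. -/
theorem hessWithin_add_of_curve {V : Type} [NormedAddCommGroup V] [NormedSpace ℝ V]
    (hD : UniqueDiffOn ℝ D) {f : Coord m → V} (hf : ContDiffOn ℝ 2 f D) {γ γ₁ : ℝ → Coord m}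
    {γ₂ : Coord m} (hγD : ∀ t, γ t ∈ D) (hγ : ∀ t, HasDerivAt γ (γ₁ t) t)
    (hγ₁ : HasDerivAt γ₁ γ₂ 0) {φ φ₁ : ℝ → V} {φ₂ : V} (hφ : ∀ t, HasDerivAt φ (φ₁ t) t)
    (hφ₁ : HasDerivAt φ₁ φ₂ 0) (h : ∀ t, f (γ t) = φ t) :
    fderivWithin ℝ f D (γ 0) (γ₁ 0) = φ₁ 0 ∧
      hessWithin D f (γ 0) (γ₁ 0) (γ₁ 0) + fderivWithin ℝ f D (γ 0) γ₂ = φ₂ := by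
  have h1 : ∀ t, fderivWithin ℝ f D (γ t) (γ₁ t) = φ₁ t := fun t => by
    have hd : HasFDerivWithinAt f (fderivWithin ℝ f D (γ t)) D (γ t) :=
      (hf.differentiableOn (by norm_num) _ (hγD t)).hasFDerivWithinAt
    have h2 := hd.comp_hasDerivWithinAt (s := univ) t (hγ t).hasDerivWithinAt (fun s _ => hγD s)
    have h3 : (f ∘ γ) = φ := funext h
    rw [hasDerivWithinAt_univ, h3] at h2
    exact h2.unique (hφ t)
  refine ⟨h1 0, ?_⟩
  have hd := (differentiableWithinAt_fderivWithin hD hf (hγD 0)).hasFDerivWithinAt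
  have h2 := hd.comp_hasDerivWithinAt (s := univ) 0 (hγ 0).hasDerivWithinAt (fun s _ => hγD s)
  rw [hasDerivWithinAt_univ] at h2
  have h3 := h2.clm_apply hγ₁
  have h4 : (fun t => (fderivWithin ℝ f D ∘ γ) t (γ₁ t)) = φ₁ := funext h1
  rw [h4] at h3
  exact h3.unique hφ₁

/-- If `q` had nonpositive time component, the reversed Cauchy–Schwarz inequality for `p` and `-q`
would give `⟨p, q⟩ ≥ 1`. -/
theorem mem_hyperboloid_of_mink_neg (p : hyperboloid m) {q : Mink m} (hq : mink q q = -1)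
    (hpq : mink p.1 q < 0) : q ∈ hyperboloid m := by
  refine ⟨hq, ?_⟩
  rw [mink_eq_inner] at hq hpq
  rw [real_inner_self_eq_norm_sq] at hq
  have hP := hyperboloid_fst_pos p
  have h0 : 0 < q.1 := by
    by_contra! hneg
    have h1 := one_add_inner_le p.1.2 (-q.2)
    rw [← hyperboloid_fst_eq, norm_neg, inner_neg_right,
      show 1 + ‖q.2‖ ^ 2 = (-q.1) ^ 2 by linarith, Real.sqrt_sq (by linarith)] at h1
    linarith
  simpa [mink_eq_inner] using h0

theorem mink_hypDeriv_self_pos {x ζ : Coord m} (hζ : ζ ≠ 0) :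
    0 < mink (hypDeriv x ζ) (hypDeriv x ζ) := by
  have hs := Real.sq_sqrt (show 0 ≤ 1 + ‖x‖ ^ 2 by positivity)
  have h1 : 0 < ‖ζ‖ := norm_pos_iff.2 hζ
  have h2 : inner ℝ x ζ ^ 2 ≤ ‖x‖ ^ 2 * ‖ζ‖ ^ 2 := by
    rw [← mul_pow, sq_le_sq, abs_of_nonneg (mul_nonneg (norm_nonneg x) (norm_nonneg ζ))]
    exact abs_real_inner_le_norm x ζ
  have h3 : mink (hypDeriv x ζ) (hypDeriv x ζ) =
      ((1 + ‖x‖ ^ 2) * ‖ζ‖ ^ 2 - inner ℝ x ζ ^ 2) / (1 + ‖x‖ ^ 2) := by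
    rw [mink_eq_inner, hypDeriv]
    simp only [real_inner_self_eq_norm_sq]
    rw [show ((Real.sqrt (1 + ‖x‖ ^ 2))⁻¹ * inner ℝ x ζ * ((Real.sqrt (1 + ‖x‖ ^ 2))⁻¹ *
      inner ℝ x ζ)) = ((Real.sqrt (1 + ‖x‖ ^ 2)) ^ 2)⁻¹ * inner ℝ x ζ ^ 2 by ring, hs]
    field_simp
    ring
  rw [h3]
  refine div_pos ?_ (by positivity)
  nlinarith [pow_pos h1 2]

theorem mink_hypPoint_eq {p : hyperboloid m} {x : Coord m} {r : ℝ}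
    (hx : coshDist p x = Real.cosh r) : mink p.1 (hypPoint x).1 = -Real.cosh r := by
  rw [← hx, coshDist_eq, neg_neg]

/-- The first and second derivatives at the boundary of a radial graph with constant boundary
values. -/
theorem boundary_derivatives {o : Mink m} {p : hyperboloid m} {r c : ℝ} (hr : 0 < r)
    {u : hyperboloid m → ℝ}
    (hu : ContDiffOn ℝ 2 (fun y => u (hypPoint y)) (closedBallCoord p r))
    (hc : ∀ q : hyperboloid m, hypDist p q = r → u q = c) {x ζ : Coord m}
    (hx : coshDist p x = Real.cosh r) (hζ : mink p.1 (hypDeriv x ζ) = 0) :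
    fderivWithin ℝ (radialGraph o u) (closedBallCoord p r) x ζ = Real.exp c • hypDeriv x ζ ∧
      hessWithin (closedBallCoord p r) (radialGraph o u) x ζ ζ =
        (mink (hypDeriv x ζ) (hypDeriv x ζ) / Real.sinh r ^ 2) •
          (fderivWithin ℝ (radialGraph o u) (closedBallCoord p r) x (x - Real.cosh r • p.1.2) -
            Real.exp c • ((hypPoint x).1 - Real.cosh r • p.1)) := by
  have hU := uniqueDiffOn_convex (convex_closedBallCoord p hr)
    (interior_closedBallCoord_nonempty p hr)
  by_cases h0 : ζ = 0
  · subst h0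
    have : hypDeriv x 0 = 0 := by simp [hypDeriv]
    simp [this, hessWithin, mink_zero_left]
  have hbpos := mink_hypDeriv_self_pos (x := x) h0
  have hbq := mink_hypPoint_hypDeriv x ζ
  have hpq := mink_hypPoint_eq hx
  have hσ := Real.sinh_pos_iff.2 hr
  have hCσ := Real.cosh_sq r
  set b := hypDeriv x ζ with hb
  set σ := Real.sinh r with hσdef
  set C := Real.cosh r with hCdef
  set q := (hypPoint x).1 with hq
  have hqq : mink q q = -1 := mink_hypPoint_self x
  have hpp : mink p.1 p.1 = -1 := p.2.1
  set a := q - C • p.1 with ha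
  -- With this frequency `a` and `b/ω` both have length `sinh r`, so `Q` is a great circle of the
  -- sphere centred at `cosh r • p`, with `Q 0 = q` and `Q' 0 = b`. It stays in the ball for all
  -- `t`, so derivatives within the ball can be taken along it.
  set ω := Real.sqrt (mink b b / σ ^ 2) with hωdef
  have hω2 : ω ^ 2 = mink b b / σ ^ 2 := Real.sq_sqrt (by positivity)
  have hω : 0 < ω := Real.sqrt_pos.2 (by positivity)
  set Q : ℝ → Mink m := fun t => C • p.1 + Real.cos (ω * t) • a + (Real.sin (ω * t) / ω) • b
    with hQ
  set Q₁ : ℝ → Mink m := fun t => (-(ω * Real.sin (ω * t))) • a + Real.cos (ω * t) • b with hQ₁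
  have hlin : ∀ t : ℝ, HasDerivAt (fun t => ω * t) ω t := fun t => by
    simpa using (hasDerivAt_id' t).const_mul ω
  have hQd : ∀ t, HasDerivAt Q (Q₁ t) t := fun t => by
    have h1 := (((hlin t).cos.smul_const a).const_add (C • p.1)).add
      (((hlin t).sin.div_const ω).smul_const b)
    refine h1.congr_deriv ?_
    rw [hQ₁]
    simp only
    rw [mul_div_cancel_right₀ _ hω.ne', neg_mul, mul_comm ω (Real.sin _)]
  have hQ₁d : HasDerivAt Q₁ (-ω ^ 2 • a) 0 := by
    have h1 := ((((hlin 0).sin.const_mul ω).neg).smul_const a).add ((hlin 0).cos.smul_const b)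
    refine h1.congr_deriv ?_
    simp [sq]
  have hpb : mink b p.1 = 0 := by rw [mink_comm]; exact hζ
  have hqb : mink b q = 0 := by rw [mink_comm]; exact hbq
  have hqp : mink q p.1 = -C := by rw [mink_comm]; exact hpq
  have hap : mink p.1 a = 0 := by
    rw [ha, mink_sub_right, mink_smul_right, hpq, hpp]; ring
  have haa : mink a a = σ ^ 2 := by
    rw [ha, mink_sub_left, mink_sub_right, mink_smul_left, ← ha, hap, mink_smul_right, hqq, hqp]
    linarith
  have hab : mink b a = 0 := by
    rw [ha, mink_sub_right, mink_smul_right, hpb, hqb]; ring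
  have hQQ : ∀ t, mink (Q t) (Q t) = -1 := fun t => by
    have h1 := Real.sin_sq_add_cos_sq (ω * t)
    have h2 : (Real.sin (ω * t) / ω) ^ 2 * mink b b = Real.sin (ω * t) ^ 2 * σ ^ 2 := by
      rw [div_pow, hω2]
      field_simp
    simp only [hQ, mink_add_left, mink_add_right, mink_smul_left, mink_smul_right, hpp, hap, haa,
      hab, hζ, mink_comm a b, mink_comm a p.1, hpb]
    linear_combination h2 + σ ^ 2 * h1 - hCσ
  have hpQ : ∀ t, mink p.1 (Q t) = -C := fun t => by
    simp only [hQ, mink_add_right, mink_smul_right, hpp, hap, hζ]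
    ring
  have hC0 : 0 < C := Real.cosh_pos r
  have hmem : ∀ t, Q t ∈ hyperboloid m := fun t =>
    mem_hyperboloid_of_mink_neg p (hQQ t) (by rw [hpQ]; linarith)
  have hpt : ∀ t, hypPoint (Q t).2 = ⟨Q t, hmem t⟩ := fun t => hypPoint_snd ⟨Q t, hmem t⟩
  have hdist : ∀ t, coshDist p (Q t).2 = C := fun t => by
    rw [coshDist_eq, hpt]
    simp [hpQ]
  have hQ0 : Q 0 = q := by simp [hQ, ha]
  have hQ₁0 : Q₁ 0 = b := by simp [hQ₁]
  have hq2 : q.2 = x := rfl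
  have hb2 : b.2 = ζ := rfl
  have key := hessWithin_add_of_curve hU (contDiffOn_radialGraph (o := o) hu)
    (γ := fun t => (Q t).2) (γ₁ := fun t => (Q₁ t).2) (γ₂ := (-ω ^ 2 • a).2)
    (φ := fun t => o + Real.exp c • Q t) (φ₁ := fun t => Real.exp c • Q₁ t)
    (φ₂ := Real.exp c • (-ω ^ 2 • a)) (fun t => (mem_closedBallCoord hr).2 (hdist t).le)
    (fun t => (ContinuousLinearMap.snd ℝ ℝ (Coord m)).hasFDerivAt.comp_hasDerivAt t (hQd t))
    ((ContinuousLinearMap.snd ℝ ℝ (Coord m)).hasFDerivAt.comp_hasDerivAt 0 hQ₁d)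
    (fun t => ((hQd t).const_smul (Real.exp c)).const_add o) (hQ₁d.const_smul (Real.exp c))
    (fun t => by
      rw [radialGraph, hc _ ((hypDist_eq_iff hr).2 (hdist t)), hpt])
  simp only [hQ0, hQ₁0, hq2, hb2] at key
  refine ⟨key.1, ?_⟩
  rw [← hω2]
  have h5 := key.2
  have h6 : (-ω ^ 2 • a).2 = -ω ^ 2 • (x - C • p.1.2) := rfl
  rw [h6, map_smul] at h5
  rw [eq_sub_of_add_eq h5, smul_comm]
  module

/-! ### The trace of the second fundamental form at the boundary -/

namespace IsNormalField

variable {X n : Coord m → Mink m} {x : Coord m}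

/-- The `m - 1` directions orthogonal to `ξ` contribute `(m - 1)β` to the trace `mH`; the rest is
the value in direction `ξ`. -/
theorem trace_eq_of_umbilic (H : IsNormalField D X n) (hx : x ∈ D) (hm : (m : ℝ) ≠ 0)
    {ξ : Coord m} {β : ℝ} (hξ : 0 < mink (fderivWithin ℝ X D x ξ) (fderivWithin ℝ X D x ξ))
    (hβ : ∀ ζ, mink (fderivWithin ℝ X D x ξ) (fderivWithin ℝ X D x ζ) = 0 →
      mink (fderivWithin ℝ n D x ζ) (fderivWithin ℝ X D x ζ) =
        β * mink (fderivWithin ℝ X D x ζ) (fderivWithin ℝ X D x ζ)) :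
    mink (fderivWithin ℝ n D x ξ) (fderivWithin ℝ X D x ξ) =
      (m * meanCurvature D X x - (m - 1) * β) *
        mink (fderivWithin ℝ X D x ξ) (fderivWithin ℝ X D x ξ) := by
  obtain ⟨F, hFi, hF⟩ := H.exists_frame hx
  have hsum := H.sum_sq_mink hx hF (fderivWithin ℝ X D x ξ)
  rw [mink_comm _ (n x), H.orthogonal x hx, zero_pow two_ne_zero, add_zero] at hsum
  have hexp : ∑ α, mink (fderivWithin ℝ X D x ξ) (fderivWithin ℝ X D x (colVec F α)) *
      mink (fderivWithin ℝ n D x ξ) (fderivWithin ℝ X D x (colVec F α)) =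
      mink (fderivWithin ℝ n D x ξ) (fderivWithin ℝ X D x ξ) := by
    conv_rhs => rw [eq_sum_of_orthonormal hF (H.mink_self x hx) (fun i => H.orthogonal x hx _)
      (fderivWithin ℝ X D x ξ), mink_comm _ (n x), H.orthogonal x hx, zero_smul, sub_zero,
      mink_sum_right]
    simp only [mink_smul_right]
  rw [H.meanCurvature_eq_sum hx hm hFi]
  set g := mink (fderivWithin ℝ X D x ξ) (fderivWithin ℝ X D x ξ) with hg
  set h := mink (fderivWithin ℝ n D x ξ) (fderivWithin ℝ X D x ξ) with hh
  have hterm : ∀ α, mink (fderivWithin ℝ n D x (colVec F α)) (fderivWithin ℝ X D x (colVec F α)) -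
      2 / g * (mink (fderivWithin ℝ X D x ξ) (fderivWithin ℝ X D x (colVec F α)) *
      mink (fderivWithin ℝ n D x ξ) (fderivWithin ℝ X D x (colVec F α))) +
      h / g ^ 2 * mink (fderivWithin ℝ X D x ξ) (fderivWithin ℝ X D x (colVec F α)) ^ 2 =
      β - β / g * mink (fderivWithin ℝ X D x ξ) (fderivWithin ℝ X D x (colVec F α)) ^ 2 :=
    fun α => by
    set s := mink (fderivWithin ℝ X D x ξ) (fderivWithin ℝ X D x (colVec F α)) with hs
    -- Removing the `ξ`-component of each frame vector avoids constructing a frame adapted to `ξ`.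
    have h1 := hβ (colVec F α - (s / g) • ξ) (by
      rw [map_sub, map_smul, mink_sub_right, mink_smul_right, ← hs, ← hg]
      field_simp
      ring)
    simp only [map_sub, map_smul, mink_sub_left, mink_sub_right, mink_smul_left,
      mink_smul_right, hF α α, if_true, H.second_fund_comm hx (colVec F α) ξ,
      mink_comm (fderivWithin ℝ X D x (colVec F α)) (fderivWithin ℝ X D x ξ), ← hs, ← hg,
      ← hh] at h1
    field_simp at h1 ⊢
    linear_combination h1
  have htot := Finset.sum_congr (rfl : (Finset.univ : Finset (Fin m)) = Finset.univ)
    fun α _ => hterm α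
  simp only [Finset.sum_add_distrib, Finset.sum_sub_distrib, ← Finset.mul_sum, hexp, hsum,
    Finset.sum_const, Finset.card_univ, Fintype.card_fin, nsmul_eq_mul] at htot
  field_simp at htot
  linear_combination -htot

end IsNormalField

end Within

/-! ### The estimate at a boundary maximum. -/

section Boundary

variable {m : ℕ}

theorem fderivWithin_sub_nonpos_of_isMaxOn {D : Set (Coord m)} (hD : Convex ℝ D)
    {G : Coord m → ℝ} {x y : Coord m} (hx : x ∈ D) (hy : y ∈ D)
    (hG : DifferentiableWithinAt ℝ G D x) (hmax : IsMaxOn G D x) :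
    fderivWithin ℝ G D x (y - x) ≤ 0 :=
  (IsMaxOn.localize hmax).hasFDerivWithinAt_nonpos hG.hasFDerivWithinAt
    (mem_posTangentConeAt_of_segment_subset (hD.segment_subset hx (by rwa [add_sub_cancel])))

/-- On a geodesic sphere on which `u` is constant, the gradient of `u` is normal to the sphere. -/
theorem hypGrad_eq_smul {o : Mink m} {p : hyperboloid m} {r c : ℝ} (hr : 0 < r)
    {u : hyperboloid m → ℝ}
    (hu : ContDiffOn ℝ 2 (fun y => u (hypPoint y)) (closedBallCoord p r))
    (hc : ∀ q : hyperboloid m, hypDist p q = r → u q = c) {x : Coord m}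
    (hx : coshDist p x = Real.cosh r) :
    ∃ μ : ℝ, hypGrad (closedBallCoord p r) (fun y => u (hypPoint y)) x =
      μ • (Real.cosh r • (hypPoint x).1 - p.1) := by
  set D := closedBallCoord p r with hD
  set v : Coord m → ℝ := fun y => u (hypPoint y) with hv
  have hU : UniqueDiffOn ℝ D := uniqueDiffOn_convex (convex_closedBallCoord p hr)
    (interior_closedBallCoord_nonempty p hr)
  have hxD : x ∈ D := (mem_closedBallCoord hr).2 hx.le
  have hd : DifferentiableWithinAt ℝ v D x := hu.differentiableOn (by norm_num) x hxD
  have hpq := mink_hypPoint_eq hx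
  have hqp : mink (hypPoint x).1 p.1 = -Real.cosh r := by rw [mink_comm]; exact hpq
  have hqq := mink_hypPoint_self x
  have hpp : mink p.1 p.1 = -1 := p.2.1
  have hσ := Real.sinh_pos_iff.2 hr
  have hCσ := Real.cosh_sq r
  set τ := Real.cosh r • (hypPoint x).1 - p.1 with hτ
  have hqτ : mink (hypPoint x).1 τ = 0 := by
    rw [hτ, mink_sub_right, mink_smul_right, hqq, hqp]; ring
  have hpτ : ∀ b, mink (hypPoint x).1 b = 0 → mink p.1 b = -mink τ b := fun b hb => by
    rw [hτ, mink_sub_left, mink_smul_left, hb]; ring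
  have hττ : mink τ τ = Real.sinh r ^ 2 := by
    have h1 := hpτ τ hqτ
    rw [hτ, mink_sub_right, mink_smul_right, hpq, hpp, ← hτ] at h1
    linarith
  set μ := fderivWithin ℝ v D x τ.2 / Real.sinh r ^ 2 with hμ
  refine ⟨μ, ?_⟩
  -- `τ` is the gradient of `coshDist p`, normal to the sphere, so `b` is the part of `Du` tangent
  -- to it. Constancy of `u` gives `⟨b, b⟩ = 0`, and the tangent space is definite.
  set b := hypGrad D v x - μ • τ with hb
  have hqb : mink (hypPoint x).1 b = 0 := by
    rw [hb, mink_sub_right, mink_smul_right, hqτ, mink_hypPoint_hypGrad]; ring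
  have hbd : hypDeriv x b.2 = b := hypDeriv_snd_of_mink_eq_zero hqb
  have hτd : hypDeriv x τ.2 = τ := hypDeriv_snd_of_mink_eq_zero hqτ
  have hGτ : mink (hypGrad D v x) τ = fderivWithin ℝ v D x τ.2 := by
    rw [← mink_hypGrad_hypDeriv, hτd]
  have hτb : mink τ b = 0 := by
    rw [hb, mink_sub_right, mink_smul_right, hττ, mink_comm, hGτ, hμ]
    field_simp
    ring
  have h1 := (boundary_derivatives (o := o) hr hu hc hx (ζ := b.2)
    (by rw [hbd, hpτ b hqb, hτb, neg_zero])).1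
  have hxc : u (hypPoint x) = c := hc _ ((hypDist_eq_iff hr).2 hx)
  rw [fderivWithin_radialGraph (hU x hxD) hd, hxc] at h1
  have h2 := smul_right_injective _ (Real.exp_pos c).ne' h1
  simp only [add_eq_right] at h2
  have h3 : fderivWithin ℝ v D x b.2 = 0 := by
    have h4 := congrArg (mink (hypPoint x).1) h2
    rw [mink_smul_right, hqq, mink_comm _ 0, mink_zero_left] at h4
    have h5 : fderivWithin ℝ v D x b.2 =
      fderivWithin ℝ (fun y => u (hypPoint y)) D x b.2 := rfl
    linarith
  have h4 : mink b b = 0 := by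
    conv_lhs => arg 1; rw [hb]
    rw [mink_sub_left, mink_smul_left, hτb, ← hbd, mink_hypGrad_hypDeriv, h3]
    ring
  have h5 : b.2 = 0 := by
    by_contra hne
    have := mink_hypDeriv_self_pos (x := x) hne
    rw [hbd] at this
    linarith
  have h6 : b = 0 := by
    rw [← hbd, h5, hypDeriv, inner_zero_right, mul_zero]
    rfl
  exact sub_eq_zero.1 h6

/-- Dividing by `|μ|` and using `M ≤ 2(M - 1)` gives `W C |μ| ≤ 2ΛE`. Since `C² ≥ σ²`, this bounds
`W²μ²σ² = W² - 1`. -/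
theorem sq_le_of_boundary_inequality {M E W C σ A Λ μ : ℝ} (hM : 2 ≤ M) (hE : 0 < E) (hW : 0 < W)
    (hC : 1 ≤ C) (hCσ : C ^ 2 = σ ^ 2 + 1) (hΛ : 0 ≤ Λ) (hμ : μ ≠ 0) (hA : |A| ≤ M * Λ)
    (h : 0 ≤ μ * A - (M - 1) * (E⁻¹ * W * C * μ ^ 2)) (hWΔ : W ^ 2 * (1 - μ ^ 2 * σ ^ 2) = 1) :
    W ^ 2 ≤ 1 + (2 * Λ * E) ^ 2 := by
  have hμa : 0 < |μ| := abs_pos.2 hμ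
  have h3 : (M - 1) * (E⁻¹ * W * C * |μ|) ≤ M * Λ := by
    have h4 : μ * A ≤ |μ| * (M * Λ) :=
      (le_abs_self _).trans (by rw [abs_mul]; gcongr)
    have h6 : |μ| * |μ| = μ ^ 2 := by rw [abs_mul_abs_self, sq]
    have h7 : |μ| * ((M - 1) * (E⁻¹ * W * C * |μ|)) = (M - 1) * (E⁻¹ * W * C * μ ^ 2) := by
      rw [← h6]; ring
    exact le_of_mul_le_mul_left (by linarith) hμa
  have h4 : E⁻¹ * W * C * |μ| ≤ 2 * Λ := by
    have h5 : M * Λ ≤ (M - 1) * (2 * Λ) := by nlinarith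
    exact le_of_mul_le_mul_left (h3.trans h5) (by linarith)
  have h5 : W * C * |μ| ≤ 2 * Λ * E := by
    refine le_of_eq_of_le ?_ (mul_le_mul_of_nonneg_right h4 hE.le)
    field_simp
  have h6 : (W * C * |μ|) ^ 2 ≤ (2 * Λ * E) ^ 2 := by gcongr
  rw [mul_pow, mul_pow, sq_abs, hCσ] at h6
  nlinarith [mul_nonneg (sq_nonneg W) (sq_nonneg μ)]

set_option maxHeartbeats 400000 in
/-- The boundary estimate for the tilt. -/
theorem tilt_sq_le_of_boundary_max {o : Mink m} {p : hyperboloid m} {r c Λ : ℝ} (hm : 2 ≤ m)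
    (hr : 0 < r) {u : hyperboloid m → ℝ}
    (hu : ContDiffOn ℝ 3 (fun y => u (hypPoint y)) (closedBallCoord p r))
    (hs : IsSpacelike (closedBallCoord p r) (radialGraph o u))
    (hc : ∀ q : hyperboloid m, hypDist p q = r → u q = c) {x : Coord m}
    (hx : coshDist p x = Real.cosh r)
    (hH : |meanCurvature (closedBallCoord p r) (radialGraph o u) x| ≤ Λ)
    (hpos : ∀ y ∈ closedBallCoord p r, 0 < supportFn o (radialGraph o u)
      (radialNormal (closedBallCoord p r) fun y => u (hypPoint y)) y)
    (hmax : IsMaxOn (testFn o (radialGraph o u)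
      (radialNormal (closedBallCoord p r) fun y => u (hypPoint y))
      ((m - 1) * Real.exp c ^ (-2 : ℤ))) (closedBallCoord p r) x) :
    (1 - mink (hypGrad (closedBallCoord p r) (fun y => u (hypPoint y)) x)
      (hypGrad (closedBallCoord p r) (fun y => u (hypPoint y)) x))⁻¹ ≤
        1 + (2 * Λ * Real.exp c) ^ 2 := by
  have hconv := convex_closedBallCoord p hr
  have N := isNormalField_radialNormal hconv (interior_closedBallCoord_nonempty p hr) hu hs
  have hu2 : ContDiffOn ℝ 2 (fun y => u (hypPoint y)) (closedBallCoord p r) :=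
    hu.of_le (by norm_num)
  obtain ⟨μ, hμ⟩ := hypGrad_eq_smul (o := o) hr hu2 hc hx
  have hbd := fun ζ => boundary_derivatives (o := o) hr hu2 hc (x := x) (ζ := ζ) hx
  have hinv := inv_cosh_smul_mem_closedBallCoord p hr
  have hxD : x ∈ closedBallCoord p r := (mem_closedBallCoord hr).2 hx.le
  set D := closedBallCoord p r with hD
  set v : Coord m → ℝ := fun y => u (hypPoint y) with hv
  set X := radialGraph o u with hX
  have hU := N.uniqueDiffOn
  have hd : DifferentiableWithinAt ℝ v D x := hu.differentiableOn (by norm_num) x hxD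
  have hlt := mink_hypGrad_self_lt_one (hU x hxD) hd hxD hs
  have hfd : ∀ ζ, fderivWithin ℝ X D x ζ = Real.exp (u (hypPoint x)) •
    (fderivWithin ℝ v D x ζ • (hypPoint x).1 + hypDeriv x ζ) :=
    fderivWithin_radialGraph (hU x hxD) hd
  have hΛ : 0 ≤ Λ := (abs_nonneg _).trans hH
  have hxc : u (hypPoint x) = c := hc _ ((hypDist_eq_iff hr).2 hx)
  have hYX : X x - o = Real.exp c • (hypPoint x).1 := by
    rw [hX, radialGraph, hxc, add_sub_cancel_left]
  rw [hxc] at hfd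
  have hpq := mink_hypPoint_eq hx
  have hqp : mink (hypPoint x).1 p.1 = -Real.cosh r := by rw [mink_comm]; exact hpq
  have hqq := mink_hypPoint_self x
  have hpp : mink p.1 p.1 = -1 := p.2.1
  have hσ := Real.sinh_pos_iff.2 hr
  have hCσ := Real.cosh_sq r
  have hC := Real.one_le_cosh r
  have hE := Real.exp_pos c
  have hm1 : (1 : ℝ) < m := by exact_mod_cast hm
  have hm0 : (m : ℝ) ≠ 0 := by positivity
  set E := Real.exp c with hEdef
  set C := Real.cosh r with hCdef
  set σ := Real.sinh r with hσdef
  set q := (hypPoint x).1 with hq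
  set τ := C • q - p.1 with hτ
  have hqτ : mink q τ = 0 := by
    rw [hτ, mink_sub_right, mink_smul_right, hqq, hqp]; ring
  have hpτ : ∀ b, mink q b = 0 → mink p.1 b = -mink τ b := fun b hb => by
    rw [hτ, mink_sub_left, mink_smul_left, hb]; ring
  have hττ : mink τ τ = σ ^ 2 := by
    have h1 := hpτ τ hqτ
    rw [hτ, mink_sub_right, mink_smul_right, hpq, hpp, ← hτ] at h1
    linarith
  have hτd : hypDeriv x τ.2 = τ := hypDeriv_snd_of_mink_eq_zero hqτ
  have hΔ : mink (hypGrad D v x) (hypGrad D v x) = μ ^ 2 * σ ^ 2 := by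
    rw [hμ, mink_smul_left, mink_smul_right, hττ]; ring
  have hdv : ∀ ζ, fderivWithin ℝ v D x ζ = μ * mink τ (hypDeriv x ζ) := fun ζ => by
    rw [← mink_hypGrad_hypDeriv, hμ, mink_smul_left]
  rw [hΔ] at hlt ⊢
  by_cases hμ0 : μ = 0
  · rw [hμ0, zero_pow two_ne_zero, zero_mul, sub_zero, inv_one]
    nlinarith [sq_nonneg (2 * Λ * E)]
  set n := radialNormal D v with hn
  set W := (Real.sqrt (1 - μ ^ 2 * σ ^ 2))⁻¹ with hW
  have h1Δ : 0 < 1 - μ ^ 2 * σ ^ 2 := by linarith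
  have hW0 : 0 < W := inv_pos.2 (Real.sqrt_pos.2 h1Δ)
  have hW2 : W ^ 2 = (1 - μ ^ 2 * σ ^ 2)⁻¹ := by rw [hW, inv_pow, Real.sq_sqrt h1Δ.le]
  have hWΔ : W ^ 2 * (1 - μ ^ 2 * σ ^ 2) = 1 := by rw [hW2, inv_mul_cancel₀ h1Δ.ne']
  have hnx : n x = W • (q + μ • τ) := by rw [hn, radialNormal, hΔ, hμ]
  have hρ : supportFn o X n x = E * W := by
    rw [supportFn, hYX, hnx]
    simp only [mink_smul_left, mink_smul_right, mink_add_right, hqq, hqτ]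
    ring
  -- Coordinates of the tangential part of the position vector, found by solving `Y = dX ξ + ρ n`
  -- with `n = W (q + μτ)` and `ρ = E W`.
  set ξ : Coord m := (-(W ^ 2 * μ)) • τ.2 with hξdef
  have hξd : hypDeriv x ξ = (-(W ^ 2 * μ)) • τ := by rw [hξdef, hypDeriv_smul, hτd]
  have hξv : fderivWithin ℝ v D x ξ = -(W ^ 2 * μ ^ 2 * σ ^ 2) := by
    rw [hdv, hξd, mink_smul_right, hττ]; ring
  have hξ : X x - o = fderivWithin ℝ X D x ξ + supportFn o X n x • n x := by
    have h1 : -(W ^ 2 * μ ^ 2 * σ ^ 2) = 1 - W ^ 2 := by linear_combination hWΔ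
    rw [hfd, hρ, hnx, hYX, hξd, hξv, h1]
    module
  have hYn : ∀ Z, mink (n x) Z = 0 → mink (fderivWithin ℝ X D x ξ) Z = mink (X x - o) Z :=
    fun Z hZ => by rw [hξ, mink_add_left, mink_smul_left, hZ]; ring
  have hgζ : ∀ ζ, mink (fderivWithin ℝ X D x ξ) (fderivWithin ℝ X D x ζ) =
      -(E ^ 2 * fderivWithin ℝ v D x ζ) := fun ζ => by
    rw [hYn _ (N.orthogonal x hxD ζ), hYX, hfd]
    simp only [mink_smul_left, mink_smul_right, mink_add_right, hq, mink_hypPoint_self,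
      mink_hypPoint_hypDeriv]
    ring
  have hgpos : 0 < mink (fderivWithin ℝ X D x ξ) (fderivWithin ℝ X D x ξ) := by
    rw [hgζ, hξv]
    have : 0 < E ^ 2 * (W ^ 2 * μ ^ 2 * σ ^ 2) := by positivity
    linarith
  set a := q - C • p.1 with ha
  have haτ : a = C • τ - σ ^ 2 • q := by
    rw [ha, hτ, show σ ^ 2 = C ^ 2 - 1 by linarith]
    module
  have hna : mink (n x) a = W * σ ^ 2 * (1 + C * μ) := by
    rw [hnx, haτ]
    simp only [mink_smul_left, mink_smul_right, mink_add_left, mink_sub_right, hqq, hqτ, hττ,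
      mink_comm τ q]
    ring
  set β := E⁻¹ * W * (1 + C * μ) with hβ
  have humb : ∀ ζ, mink (fderivWithin ℝ X D x ξ) (fderivWithin ℝ X D x ζ) = 0 →
      mink (fderivWithin ℝ n D x ζ) (fderivWithin ℝ X D x ζ) =
        β * mink (fderivWithin ℝ X D x ζ) (fderivWithin ℝ X D x ζ) := fun ζ hζ => by
    rw [hgζ, hdv] at hζ
    have h1 : mink τ (hypDeriv x ζ) = 0 := by
      have h2 : E ^ 2 * μ ≠ 0 := by positivity
      have h3 : E ^ 2 * μ * mink τ (hypDeriv x ζ) = 0 := by linarith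
      exact (mul_eq_zero.1 h3).resolve_left h2
    -- As `μ ≠ 0`, orthogonality to `ξ` means tangency to the sphere. In the second derivative only
    -- the term in `a` survives pairing with `n`, and this produces `β`.
    obtain ⟨h4, h5⟩ := hbd ζ (by rw [hpτ _ (mink_hypPoint_hypDeriv x ζ), h1, neg_zero])
    rw [N.weingarten hxD, h5, h4, mink_smul_right, mink_sub_right, N.orthogonal x hxD,
      mink_smul_right, hna, mink_smul_left, mink_smul_right, hβ]
    field_simp
    ring
  have htr := N.trace_eq_of_umbilic hxD hm0 hgpos humb
  set g := mink (fderivWithin ℝ X D x ξ) (fderivWithin ℝ X D x ξ) with hg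
  set A := m * meanCurvature D X x with hA
  have hGξ := N.fderivWithin_testFn (k := (m - 1) * E ^ (-2 : ℤ)) hpos hxD ξ
  rw [← hYn _ (N.mink_deriv_normal hxD ξ), ← hYn _ (N.orthogonal x hxD ξ),
    mink_comm _ (fderivWithin ℝ n D x ξ), htr, hρ, ← hg] at hGξ
  set G := testFn o X n ((m - 1) * E ^ (-2 : ℤ)) with hG
  have hGd : DifferentiableWithinAt ℝ G D x :=
    (N.contDiffOn_testFn hpos).differentiableOn (by norm_num) x hxD
  have hGτ : 0 ≤ fderivWithin ℝ G D x τ.2 := by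
    have h1 := fderivWithin_sub_nonpos_of_isMaxOn hconv hxD hinv hGd hmax
    -- The point `C⁻¹ • p.1.2` of the ball lies exactly in the direction `-τ` from `x`, so
    -- maximality makes the outward derivative nonnegative.
    have h2 : C⁻¹ • p.1.2 - x = (-C⁻¹) • τ.2 := by
      have h3 : τ.2 = C • x - p.1.2 := rfl
      rw [h3, smul_sub, smul_smul, neg_mul, inv_mul_cancel₀ (by linarith)]
      module
    rw [h2, map_smul, smul_eq_mul, neg_mul] at h1
    have h4 : 0 < C⁻¹ := inv_pos.2 (by linarith)
    have h5 : 0 ≤ C⁻¹ * fderivWithin ℝ G D x τ.2 := by linarith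
    exact (mul_nonneg_iff_of_pos_left h4).1 h5
  rw [hξdef, map_smul, smul_eq_mul] at hGξ
  -- Here `k = (m - 1)/E²` pays off: `kρ = (m - 1) W/E` cancels the constant part of `(m - 1)β = (m
  -- - 1) E⁻¹ W (1 + Cμ)`.
  have hkey : g * (μ * A - (m - 1) * (E⁻¹ * W * C * μ ^ 2)) =
      E * W ^ 3 * μ ^ 2 * fderivWithin ℝ G D x τ.2 := by
    have h1 : E ^ (-2 : ℤ) = (E ^ 2)⁻¹ := by
      rw [zpow_neg]; norm_cast
    rw [h1, hβ] at hGξ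
    field_simp at hGξ ⊢
    linear_combination hGξ
  have h1 : 0 ≤ μ * A - (m - 1) * (E⁻¹ * W * C * μ ^ 2) :=
    by
    refine (mul_nonneg_iff_of_pos_left hgpos).1 ?_
    rw [hkey]
    exact mul_nonneg (by positivity) hGτ
  rw [← hW2]
  refine sq_le_of_boundary_inequality (A := A) (by exact_mod_cast hm) hE hW0 hC hCσ hΛ hμ0 ?_ h1 hWΔ
  rw [hA, abs_mul, Nat.abs_cast]
  gcongr

end Boundary

end RadialGraph

/-! ### Assembly of the interior and boundary estimates. -/

open RadialGraph
theorem mainTheorem5 (m : ℕ) (hm : 2 ≤ m) (l L Λ R : ℝ) (hl0 : 0 < l) (hl1 : l ≤ 1) (hL : 1 ≤ L)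
    (hΛ : 0 < Λ) (hR : 0 < R) :
    ∃ C : ℝ, ∀ (o : Mink m) (p : hyperboloid m) (r : ℝ), R < r → ∀ u : hyperboloid m → ℝ,
      -- `u` is of class `C³` on the closed geodesic ball
      ContDiffOn ℝ 3 (fun x => u (hypPoint x)) (closedBallCoord p r) →
      -- the radial graph of `u` over the closed geodesic ball is spacelike
      IsSpacelike (closedBallCoord p r) (radialGraph o u) →
      (∀ q : hyperboloid m, hypDist p q ≤ r → Real.log l ≤ u q ∧ u q ≤ Real.log L) →
      (∀ x : Coord m, hypDist p (hypPoint x) < r →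
        |meanCurvature (closedBallCoord p r) (radialGraph o u) x| ≤ Λ ∧
        gradNorm (closedBallCoord p r) (radialGraph o u)
            (meanCurvature (closedBallCoord p r) (radialGraph o u)) x ≤
          Λ * tilt (closedBallCoord p r) o u x) →
      (∃ c : ℝ, ∀ q : hyperboloid m, hypDist p q = r → u q = c) →
      ∀ x ∈ closedBallCoord p r,
        hypGradNorm (closedBallCoord p r) u x < 1 ∧
        tilt (closedBallCoord p r) o u x =
          1 / Real.sqrt (1 - hypGradNorm (closedBallCoord p r) u x ^ 2) ∧
        tilt (closedBallCoord p r) o u x ≤ C := by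
  have hm1 : (1 : ℝ) < m := by exact_mod_cast hm
  have hL0 : 0 < L := by linarith
  set k₁ : ℝ := (m - 1) / L ^ 2 with hk₁
  set k₂ : ℝ := (m - 1) / l ^ 2 with hk₂
  have hk₁0 : 0 < k₁ := div_pos (by linarith) (by positivity)
  have hk₂0 : 0 < k₂ := div_pos (by linarith) (by positivity)
  -- The sum dominates the three possible bounds for `ρ` at a maximum: `ρ ≤ ℓ ≤ L`, the interior
  -- estimate and the boundary estimate. The numbers `k₁ ≤ k ≤ k₂` remove the dependence on `c`.
  set C₀ : ℝ := L + ((m - 1) * (m * (Λ / l ^ 2 + Λ / l + Λ * k₂ + k₂ / l)) +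
    2 * (m * Λ) * k₂) / k₁ ^ 2 + L * Real.sqrt (1 + (2 * Λ * L) ^ 2) with hC₀
  refine ⟨C₀ * Real.exp (k₂ * (L ^ 2 / 2)) / l, ?_⟩
  intro o p r hRr u hu hs hbound hmean hconst
  have hr : 0 < r := hR.trans hRr
  have hconv := convex_closedBallCoord p hr
  have hcomp := isCompact_closedBallCoord p hr
  have hint := setOf_coshDist_lt_subset_interior p hr
  have hnonempty := interior_closedBallCoord_nonempty p hr
  have N := isNormalField_radialNormal hconv hnonempty hu hs
  have hbdry := fun c x =>
    tilt_sq_le_of_boundary_max (o := o) (c := c) (Λ := Λ) (x := x) hm hr hu hs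
  obtain ⟨c, hc, hcl, hcL⟩ : ∃ c : ℝ, (∀ q : hyperboloid m, hypDist p q = r → u q = c) ∧
      l ≤ Real.exp c ∧ Real.exp c ≤ L := by
    obtain ⟨c, hc⟩ := hconst
    by_cases h : ∃ q : hyperboloid m, hypDist p q = r
    · obtain ⟨q, hq⟩ := h
      refine ⟨c, hc, ?_⟩
      rw [← hc q hq]
      obtain ⟨h1, h2⟩ := hbound q hq.le
      exact ⟨(Real.log_le_iff_le_exp hl0).1 h1, (Real.le_log_iff_exp_le hL0).1 h2⟩
    -- If the sphere were empty, any `c` would do; `c = 0` is admissible because `l ≤ 1 ≤ L`.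
    · exact ⟨0, fun q hq => absurd ⟨q, hq⟩ h, by simpa using hl1, by simpa using hL⟩
  have hE : ∀ x ∈ closedBallCoord p r, l ≤ Real.exp (u (hypPoint x)) ∧
      Real.exp (u (hypPoint x)) ≤ L := fun x hx => by
    obtain ⟨h1, h2⟩ := hbound (hypPoint x) hx
    exact ⟨(Real.log_le_iff_le_exp hl0).1 h1, (Real.le_log_iff_exp_le hL0).1 h2⟩
  set D := closedBallCoord p r with hD
  set v : Coord m → ℝ := fun y => u (hypPoint y) with hv
  set n := radialNormal D v with hn
  set X := radialGraph o u with hX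
  have hU := N.uniqueDiffOn
  have hlt : ∀ x ∈ D, mink (hypGrad D v x) (hypGrad D v x) < 1 := fun x hx =>
    mink_hypGrad_self_lt_one (hU x hx) (hu.differentiableOn (by norm_num) x hx) hx hs
  have hYX : ∀ x, X x - o = Real.exp (u (hypPoint x)) • (hypPoint x).1 := fun x => by
    rw [hX, radialGraph, add_sub_cancel_left]
  have hYY : ∀ x, mink (X x - o) (X x - o) = -Real.exp (u (hypPoint x)) ^ 2 := fun x => by
    rw [hYX, mink_smul_left, mink_smul_right, mink_hypPoint_self]; ring
  have htilt : ∀ x ∈ D, tilt D o u x =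
      (Real.sqrt (1 - mink (hypGrad D v x) (hypGrad D v x)))⁻¹ := fun x hx => by
    rw [tilt, positionField_radialGraph, N.unitNormal_eq hx, mink_hypPoint_radialNormal, neg_neg]
  have hsupp : ∀ x ∈ D, supportFn o X n x = Real.exp (u (hypPoint x)) * tilt D o u x :=
    fun x hx => by
    rw [supportFn, hYX, mink_smul_left, mink_hypPoint_radialNormal, htilt x hx]; ring
  have htpos : ∀ x ∈ D, 0 < tilt D o u x := fun x hx => by
    rw [htilt x hx]
    exact inv_pos.2 (Real.sqrt_pos.2 (by linarith [hlt x hx]))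
  have hpos : ∀ x ∈ D, 0 < supportFn o X n x := fun x hx => by
    rw [hsupp x hx]
    exact mul_pos (Real.exp_pos _) (htpos x hx)
  set k : ℝ := (m - 1) * Real.exp c ^ (-2 : ℤ) with hk
  have hk' : k = (m - 1) / Real.exp c ^ 2 := by
    rw [hk, zpow_neg, div_eq_mul_inv]; norm_cast
  have hk1 : k₁ ≤ k := by
    rw [hk', hk₁]
    have := Real.exp_pos c
    gcongr
  have hk2 : k ≤ k₂ := by
    rw [hk', hk₂]
    gcongr
  have hk0 : 0 < k := hk₁0.trans_le hk1
  have hkey : ∀ x₀ ∈ D, IsMaxOn (testFn o X n k) D x₀ → supportFn o X n x₀ ≤ C₀ := by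
    intro x₀ hx₀ hmax
    have hpart2 : 0 ≤ ((m - 1) * (m * (Λ / l ^ 2 + Λ / l + Λ * k₂ + k₂ / l)) +
        2 * (m * Λ) * k₂) / k₁ ^ 2 :=
      div_nonneg (add_nonneg (mul_nonneg (by linarith) (by positivity)) (by positivity))
        (by positivity)
    have hpart3 : 0 ≤ L * Real.sqrt (1 + (2 * Λ * L) ^ 2) := by positivity
    rcases lt_or_eq_of_le ((mem_closedBallCoord hr).1 hx₀) with hin | hon
    · have hi : x₀ ∈ interior D := hint hin
      obtain ⟨hH, hgrad⟩ := hmean x₀ ((hypDist_lt_iff hr).2 hin)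
      have ht : tilt D o u x₀ = supportFn o X n x₀ / Real.exp (u (hypPoint x₀)) := by
        rw [hsupp x₀ hx₀]
        field_simp
      rw [ht] at hgrad
      rcases N.supportFn_le_of_isLocalMax hm hpos hi
        (hmax.isLocalMax (mem_interior_iff_mem_nhds.1 hi)) hk0 hl0 (hE x₀ hx₀).1 (hYY x₀) hH hgrad
        with h | h
      · linarith [(hE x₀ hx₀).2]
      · have h1 : k₁ ^ 2 * supportFn o X n x₀ ≤
            (m - 1) * (m * (Λ / l ^ 2 + Λ / l + Λ * k₂ + k₂ / l)) + 2 * (m * Λ) * k₂ := by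
          have hm1' : (0 : ℝ) ≤ m - 1 := by linarith
          calc k₁ ^ 2 * supportFn o X n x₀ ≤ k ^ 2 * supportFn o X n x₀ := by
                have := hpos x₀ hx₀
                gcongr
            _ ≤ _ := h
            _ ≤ _ := by gcongr
        have h2 : supportFn o X n x₀ ≤ ((m - 1) * (m * (Λ / l ^ 2 + Λ / l + Λ * k₂ + k₂ / l)) +
            2 * (m * Λ) * k₂) / k₁ ^ 2 := by
          rw [le_div_iff₀ (by positivity)]
          linarith
        linarith
    · have hH : |meanCurvature D X x₀| ≤ Λ := by
        -- The bound on `H` is assumed only in the open ball; continuity extends it to the boundary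
        -- point.
        have hcont : ContinuousWithinAt (meanCurvature D X) {y | coshDist p y < Real.cosh r} x₀ :=
          (N.differentiableWithinAt_meanCurvature hx₀).continuousWithinAt.mono
            (hint.trans interior_subset)
        exact ContinuousWithinAt.closure_le (mem_closure_setOf_coshDist_lt hr hon.le) hcont.abs
          continuousWithinAt_const fun y hy => (hmean y ((hypDist_lt_iff hr).2 hy)).1
      have h1 := hbdry c x₀ hc hon hH hpos hmax
      have h2 : tilt D o u x₀ ≤ Real.sqrt (1 + (2 * Λ * L) ^ 2) := by
        rw [htilt x₀ hx₀, ← Real.sqrt_inv]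
        refine Real.sqrt_le_sqrt (h1.trans ?_)
        gcongr
      have h3 : supportFn o X n x₀ ≤ L * Real.sqrt (1 + (2 * Λ * L) ^ 2) := by
        rw [hsupp x₀ hx₀]
        have := (htpos x₀ hx₀).le
        gcongr
        exact (hE x₀ hx₀).2
      linarith
  intro x hx
  have hgn : hypGradNorm D u x = Real.sqrt (mink (hypGrad D v x) (hypGrad D v x)) :=
    hypGradNorm_eq (hU x hx)
  refine ⟨?_, ?_, ?_⟩
  · rw [hgn, Real.sqrt_lt' one_pos, one_pow]
    exact hlt x hx
  · rw [hgn, Real.sq_sqrt (mink_hypGrad_self_nonneg v x), htilt x hx, one_div]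
  · obtain ⟨x₀, hx₀, hmax⟩ := hcomp.exists_isMaxOn ⟨x, hx⟩
      (N.contDiffOn_testFn (k := k) hpos).continuousOn
    have h1 := hkey x₀ hx₀ hmax
    have h2 : testFn o X n k x ≤ testFn o X n k x₀ := hmax hx
    rw [testFn, testFn, hYY, hYY] at h2
    -- The oscillation of `kℓ²/2` is at most `k₂L²/2`, so passing from the maximum of `G` to any
    -- point costs a factor `exp (k₂L²/2)`; the final division by `l` turns `ρ = e^u w` into `w`.
    have h3 : Real.log (supportFn o X n x) ≤ Real.log (supportFn o X n x₀) + k₂ * (L ^ 2 / 2) := by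
      have h4 : k * (Real.exp (u (hypPoint x₀)) ^ 2 / 2) ≤ k₂ * (L ^ 2 / 2) := by
        have := (hE x₀ hx₀).2
        gcongr
      have h5 : 0 ≤ k * (Real.exp (u (hypPoint x)) ^ 2 / 2) := by positivity
      rw [neg_neg, neg_neg] at h2
      linarith
    have h4 : supportFn o X n x ≤ supportFn o X n x₀ * Real.exp (k₂ * (L ^ 2 / 2)) := by
      rw [← Real.log_le_log_iff (hpos x hx) (mul_pos (hpos x₀ hx₀) (Real.exp_pos _)),
        Real.log_mul (hpos x₀ hx₀).ne' (Real.exp_pos _).ne', Real.log_exp]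
      exact h3
    rw [le_div_iff₀ hl0]
    calc tilt D o u x * l ≤ tilt D o u x * Real.exp (u (hypPoint x)) := by
          have := (htpos x hx).le
          gcongr
          exact (hE x hx).1
      _ = supportFn o X n x := by rw [hsupp x hx, mul_comm]
      _ ≤ _ := h4
      _ ≤ _ := by gcongr
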